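/- **Auslander's defect formula for exact categories.** Let $k$ be a commutative artinian ring, let $\check k$ be a minimal injective cogenerator over $k$, and let $D=\operatorname{Hom}_k(-,\check k)$. Let $\mathcal C$ be a $k$-linear Hom-finite Krull–Schmidt exact category (in the sense of Quillen and Keller). Write $\operatorname{Ext}(X,Y)$ for the $k$-module (under Baer sum) of equivalence classes of conflations $Y\to E\to X$; for such a class $\xi$ let $\xi.f$ and $g.\xi$ denote its pullback along $f$ and its pushout along $g$. A morphism $f$ is *projectively trivial* if $\operatorname{Ext}(f,Z)=0$ for all $Z$, and *injectively trivial* if $\operatorname{Ext}(Z,f)=0$ for all $Z$. Let $\underline{\mathcal C}$ (resp. $\overline{\mathcal C}$) be the quotient of $\mathcal C$ by the ideal of projectively (resp. injectively) trivial morphisms. Let $\mathcal C_r$ be the full subcategory of those $X\in\mathcal C$ for which the functor $D\operatorname{Ext}(X,-)$ on $\overline{\mathcal C}$ is representable, and let $\mathcal C_l$ be the full subcategory of those $X\in\mathcal C$ for which the functor $D\operatorname{Ext}(-,X)$ on $\underline{\mathcal C}$ is representable. For $K\in\mathcal C_r$ choose an object $\tau K$ and an isomorphism $\operatorname{Hom}_{\overline{\mathcal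 C}}(-,\tau K)\cong D\operatorname{Ext}(K,-)$; for $K\in\mathcal C_l$ choose an object $\tau^-K$ and an isomorphism $\operatorname{Hom}_{\underline{\mathcal C}}(\tau^-K,-)\cong D\operatorname{Ext}(-,K)$. Let $\tau$ and $\tau^-$ act on morphisms in the unique way that makes these isomorphisms natural in $K$; so $\tau$ is a functor on the image $\underline{\mathcal C_r}$ of $\mathcal C_r$ in $\underline{\mathcal C}$ with values in $\overline{\mathcal C}$, and $\tau^-$ is a functor on the image $\overline{\mathcal C_l}$ of $\mathcal C_l$ in $\overline{\mathcal C}$ with values in $\underline{\mathcal C}$. For a conflation $\xi\colon X\xrightarrow{i}E\xrightarrow{d}Y$ define the covariant and the contravariant defect by $$\xi_*(K)=\operatorname{Coker}\bigl(\operatorname{Hom}(E,K)\xrightarrow{\,-\circ i\,}\operatorname{Hom}(X,K)\bigr),\qquad \xi^*(K)=\operatorname{Coker}\bigl(\operatorname{Hom}(K,E)\xrightarrow{\,d\circ-\,}\operatorname{Hom}(K,Y)\bigr),$$ which induce functors on $\overline{\mathcal C}$ and on $\underline{\mathcal C}^{\mathrm{op}}$, respectively. Then the following hold. 1. There are $k$-linear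 isomorphisms $\xi_*(\tau K)\cong D\,\xi^*(K)$ for all conflations $\xi$ in $\mathcal C$ and all $K\in\mathcal C_r$, natural in $\xi$ (with respect to morphisms of conflations) and in $K\in\underline{\mathcal C_r}$. 2. There are $k$-linear isomorphisms $\xi^*(\tau^-K)\cong D\,\xi_*(K)$ for all conflations $\xi$ in $\mathcal C$ and all $K\in\mathcal C_l$, natural in $\xi$ (with respect to morphisms of conflations) and in $K\in\overline{\mathcal C_l}$. -/

import Mathlib

open CategoryTheory CategoryTheory.Limits Opposite

universe v u w

noncomputable section

namespace AuslanderDefect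

attribute [local instance] hasBinaryBiproducts_of_finite_biproducts

/-! ### Exact categories -/

section ConflationPredicates

variable {C : Type u} [Category.{v} C] [Preadditive C]

/-- `d` is the second map of a pair belonging to `P`. -/
def IsDeflationFor (P : ObjectProperty (ShortComplex C)) {E Y : C} (d : E ⟶ Y) : Prop :=
  ∃ (X : C) (i : X ⟶ E) (h : i ≫ d = 0), P (ShortComplex.mk i d h)

/-- `i` is the first map of a pair belonging to `P`. -/
def IsInflationFor (P : ObjectProperty (ShortComplex C)) {X E : C} (i : X ⟶ E) : Prop :=
  ∃ (Y : C) (d : E ⟶ Y) (h : i ≫ d = 0), P (ShortComplex.mk i d h)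

end ConflationPredicates

/-- An exact category in the sense of Quillen and Keller: an additive category with a class of
kernel-cokernel pairs `X ⟶ E ⟶ Y` (the conflations), closed under isomorphism, such that the zero
pair is a conflation, deflations and inflations compose, deflations admit base change
along arbitrary morphisms, and inflations admit cobase change. -/
class ExactCategory (C : Type u) [Category.{v} C] [Preadditive C] [HasFiniteBiproducts C] where
  conflation : ObjectProperty (ShortComplex C)
  isKernel : ∀ S : ShortComplex C, conflation S → Nonempty (IsLimit (KernelFork.ofι S.f S.zero))
  isCokernel : ∀ S : ShortComplex C, conflation S →
    Nonempty (IsColimit (CokernelCofork.ofπ S.g S.zero))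
  of_iso : ∀ S T : ShortComplex C, Nonempty (S ≅ T) → conflation S → conflation T
  zero_mem : ∀ S : ShortComplex C, IsZero S.X₁ → IsZero S.X₂ → IsZero S.X₃ → conflation S
  deflation_comp : ∀ {X Y Z : C} (d : X ⟶ Y) (d' : Y ⟶ Z),
    IsDeflationFor conflation d → IsDeflationFor conflation d' →
      IsDeflationFor conflation (d ≫ d')
  inflation_comp : ∀ {X Y Z : C} (i : X ⟶ Y) (i' : Y ⟶ Z),
    IsInflationFor conflation i → IsInflationFor conflation i' →
      IsInflationFor conflation (i ≫ i')
  exists_pullback : ∀ {E Y Z : C} (d : E ⟶ Y) (f : Z ⟶ Y), IsDeflationFor conflation d →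
    ∃ (P : C) (f' : P ⟶ E) (d' : P ⟶ Z), IsPullback f' d' d f ∧ IsDeflationFor conflation d'
  exists_pushout : ∀ {X E Z : C} (i : X ⟶ E) (g : X ⟶ Z), IsInflationFor conflation i →
    ∃ (P : C) (g' : E ⟶ P) (i' : Z ⟶ P), IsPushout i g g' i' ∧ IsInflationFor conflation i'

/-- A category is Krull-Schmidt if every object is a finite direct sum of objects with local
endomorphism rings. -/
class KrullSchmidt (C : Type u) [Category.{v} C] [Preadditive C] [HasFiniteBiproducts C] :
    Prop where
  exists_decomposition : ∀ X : C, ∃ (n : ℕ) (F : Fin n → C),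
    (∀ i, IsLocalRing (End (F i))) ∧ Nonempty (X ≅ ⨁ F)

section ExactCategory

variable {C : Type u} [Category.{v} C] [Preadditive C] [HasFiniteBiproducts C] [ExactCategory C]

variable (C) in
/-- The category of conflations of `C`; morphisms are commutative diagrams. -/
abbrev Conflation : Type _ := (ExactCategory.conflation (C := C)).FullSubcategory

/-- A morphism of `C` which is the first map of a conflation. -/
abbrev IsInflation {X E : C} (i : X ⟶ E) : Prop :=
  IsInflationFor (ExactCategory.conflation (C := C)) i

/-- A morphism of `C` which is the second map of a conflation. -/
abbrev IsDeflation {E Y : C} (d : E ⟶ Y) : Prop :=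
  IsDeflationFor (ExactCategory.conflation (C := C)) d

/-- Conflations `X ⟶ E ⟶ Y` with fixed end terms: extensions of `Y` by `X`. -/
structure Extension (Y X : C) where
  E : C
  i : X ⟶ E
  d : E ⟶ Y
  w : i ≫ d = 0
  mem : ExactCategory.conflation (ShortComplex.mk i d w)

namespace Extension

variable {X Y Z W : C}

/-- The extension underlying a conflation. -/
def ofConflation (ξ : Conflation C) : Extension ξ.obj.X₃ ξ.obj.X₁ :=
  ⟨ξ.obj.X₂, ξ.obj.f, ξ.obj.g, ξ.obj.zero, ξ.property⟩

lemma isDeflation (a : Extension Y X) : IsDeflation a.d := ⟨_, _, _, a.mem⟩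

lemma isInflation (a : Extension Y X) : IsInflation a.i := ⟨_, _, _, a.mem⟩

lemma exists_lift (a : Extension Y X) {T : C} (t : T ⟶ a.E) (h : t ≫ a.d = 0) :
    ∃ s : T ⟶ X, s ≫ a.i = t := by
  obtain ⟨l⟩ := ExactCategory.isKernel _ a.mem
  exact ⟨l.lift (KernelFork.ofι t h), l.fac (KernelFork.ofι t h) WalkingParallelPair.zero⟩

lemma exists_desc (a : Extension Y X) {T : C} (t : a.E ⟶ T) (h : a.i ≫ t = 0) :
    ∃ s : Y ⟶ T, a.d ≫ s = t := by
  obtain ⟨l⟩ := ExactCategory.isCokernel _ a.mem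
  exact ⟨l.desc (CokernelCofork.ofπ t h), l.fac (CokernelCofork.ofπ t h) WalkingParallelPair.one⟩

lemma mono_i (a : Extension Y X) : Mono a.i := by
  obtain ⟨l⟩ := ExactCategory.isKernel _ a.mem
  exact mono_of_isLimit_fork l

lemma epi_d (a : Extension Y X) : Epi a.d := by
  obtain ⟨l⟩ := ExactCategory.isCokernel _ a.mem
  exact epi_of_isColimit_cofork l

end Extension

/-- A deflation together with a kernel of it is a conflation. -/
lemma conflation_of_deflation {X E Y : C} (i : X ⟶ E) (d : E ⟶ Y) (w : i ≫ d = 0)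
    (hd : IsDeflation d) [Mono i] (h : ∀ {T : C} (t : T ⟶ E), t ≫ d = 0 → ∃ s, s ≫ i = t) :
    ExactCategory.conflation (ShortComplex.mk i d w) := by
  obtain ⟨X', i', w', hc⟩ := hd
  let a : Extension Y X' := ⟨E, i', d, w', hc⟩
  obtain ⟨s, hs⟩ := h i' w'
  obtain ⟨t, ht⟩ := a.exists_lift i w
  change t ≫ i' = i at ht
  have : Mono i' := a.mono_i
  refine ExactCategory.of_iso (ShortComplex.mk i' d w') _
    ⟨ShortComplex.isoMk ⟨s, t, ?_, ?_⟩ (Iso.refl _) (Iso.refl _) ?_ ?_⟩ hc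
  · rw [← cancel_mono i', Category.assoc, ht, hs, Category.id_comp]
  · rw [← cancel_mono i, Category.assoc, hs, ht, Category.id_comp]
  · simp [hs]
  · simp

/-- An inflation together with a cokernel of it is a conflation. -/
lemma conflation_of_inflation {X E Y : C} (i : X ⟶ E) (d : E ⟶ Y) (w : i ≫ d = 0)
    (hi : IsInflation i) [Epi d] (h : ∀ {T : C} (t : E ⟶ T), i ≫ t = 0 → ∃ s, d ≫ s = t) :
    ExactCategory.conflation (ShortComplex.mk i d w) := by
  obtain ⟨Y', d', w', hc⟩ := hi
  let a : Extension Y' X := ⟨E, i, d', w', hc⟩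
  obtain ⟨s, hs⟩ := h d' w'
  obtain ⟨t, ht⟩ := a.exists_desc d w
  change d' ≫ t = d at ht
  have : Epi d' := a.epi_d
  refine ExactCategory.of_iso (ShortComplex.mk i d' w') _
    ⟨ShortComplex.isoMk (Iso.refl _) (Iso.refl _) ⟨t, s, ?_, ?_⟩ ?_ ?_⟩ hc
  · rw [← cancel_epi d', ← Category.assoc, ht, hs, Category.comp_id]
  · rw [← cancel_epi d, ← Category.assoc, hs, ht, Category.comp_id]
  · simp
  · simp [ht]

namespace Extension

variable {X Y Z W : C}

/-- Two extensions are equivalent if there is an isomorphism of the middle terms which is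
compatible with the identities of the end terms. -/
def Equivalent (a b : Extension Y X) : Prop :=
  ∃ e : a.E ≅ b.E, a.i ≫ e.hom = b.i ∧ e.hom ≫ b.d = a.d

instance setoid (Y X : C) : Setoid (Extension Y X) where
  r := Equivalent
  iseqv :=
    { refl := fun a => ⟨Iso.refl _, by simp, by simp⟩
      symm := by
        rintro a b ⟨e, h₁, h₂⟩
        exact ⟨e.symm, by simp [← h₁], by simp [← h₂]⟩
      trans := by
        rintro a b c ⟨e, h₁, h₂⟩ ⟨e', h₃, h₄⟩
        exact ⟨e ≪≫ e', by simp [reassoc_of% h₁, h₃], by simp [h₄, h₂]⟩ }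

/-- The short five lemma. -/
lemma equivalent_of_hom (a b : Extension Y X) (e : a.E ⟶ b.E) (h₁ : a.i ≫ e = b.i)
    (h₂ : e ≫ b.d = a.d) : Equivalent a b := by
  have := a.mono_i
  have := b.mono_i
  have := a.epi_d
  have := b.epi_d
  have he : Mono e := by
    refine Preadditive.mono_of_cancel_zero _ fun {T} t ht => ?_
    obtain ⟨s, rfl⟩ := a.exists_lift t (by rw [← h₂, reassoc_of% ht, zero_comp])
    have : s ≫ b.i = 0 := by rw [← h₁, ← Category.assoc, ht]
    rw [zero_of_comp_mono b.i this, zero_comp]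
  obtain ⟨P, p, q, hP, Q, j, w, hq⟩ := ExactCategory.exists_pullback a.d b.d a.isDeflation
  let c : Extension b.E Q := ⟨P, j, q, w, hq⟩
  obtain ⟨l, hl⟩ := b.exists_lift (p ≫ e - q) (by simp [h₂, hP.w])
  have hv : (p - l ≫ a.i) ≫ e = q := by simp [h₁, hl]
  obtain ⟨f, hf⟩ := c.exists_desc (p - l ≫ a.i) (by
    rw [← cancel_mono e, Category.assoc, zero_comp]
    exact (congrArg (j ≫ ·) hv).trans w)
  change q ≫ f = _ at hf
  have : Epi q := c.epi_d
  have h3 : f ≫ e = 𝟙 _ := by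
    rw [← cancel_epi q, ← Category.assoc, hf, hv, Category.comp_id]
  have h4 : e ≫ f = 𝟙 _ := by
    rw [← cancel_mono e, Category.assoc, h3, Category.comp_id, Category.id_comp]
  exact ⟨⟨e, f, h4, h3⟩, h₁, h₂⟩

lemma exists_pull (a : Extension Y X) (f : Z ⟶ Y) :
    ∃ (b : Extension Z X) (p : b.E ⟶ a.E), b.i ≫ p = a.i ∧ IsPullback p b.d a.d f := by
  obtain ⟨P, p, q, hP, hq⟩ := ExactCategory.exists_pullback a.d f a.isDeflation
  have := a.mono_i
  let i : X ⟶ P := hP.lift a.i 0 (by simp [a.w])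
  have hip : i ≫ p = a.i := hP.lift_fst ..
  have : Mono (i ≫ p) := by rw [hip]; infer_instance
  have : Mono i := mono_of_mono i p
  refine ⟨⟨P, i, q, hP.lift_snd .., conflation_of_deflation _ _ _ hq fun t ht => ?_⟩, p, hip, hP⟩
  obtain ⟨s, hs⟩ := a.exists_lift (t ≫ p) (by rw [Category.assoc, hP.w, reassoc_of% ht, zero_comp])
  refine ⟨s, hP.hom_ext (by simp [hip, hs]) ?_⟩
  rw [ht, Category.assoc, hP.lift_snd, comp_zero]

lemma exists_push (a : Extension Y X) (g : X ⟶ Z) :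
    ∃ (b : Extension Y Z) (p : a.E ⟶ b.E), p ≫ b.d = a.d ∧ IsPushout a.i g p b.i := by
  obtain ⟨P, p, q, hP, hq⟩ := ExactCategory.exists_pushout a.i g a.isInflation
  have := a.epi_d
  let d : P ⟶ Y := hP.desc a.d 0 (by simp [a.w])
  have hip : p ≫ d = a.d := hP.inl_desc ..
  have : Epi (p ≫ d) := by rw [hip]; infer_instance
  have : Epi d := epi_of_epi p d
  refine ⟨⟨P, q, d, hP.inr_desc .., conflation_of_inflation _ _ _ hq fun t ht => ?_⟩, p, hip, hP⟩
  obtain ⟨s, hs⟩ := a.exists_desc (p ≫ t) (by rw [← Category.assoc, hP.w, Category.assoc, ht,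
    comp_zero])
  refine ⟨s, hP.hom_ext (by rw [← Category.assoc, hip, hs]) ?_⟩
  rw [ht, ← Category.assoc, hP.inr_desc, zero_comp]

/-- The pullback `ξ.f` of an extension along `f`. -/
def pull (f : Z ⟶ Y) (a : Extension Y X) : Extension Z X := (a.exists_pull f).choose

/-- The pushout `g.ξ` of an extension along `g`. -/
def push (g : X ⟶ Z) (a : Extension Y X) : Extension Y Z := (a.exists_push g).choose

/-- The canonical map from the middle term of `ξ.f` to the middle term of `ξ`. -/
def pullHom (f : Z ⟶ Y) (a : Extension Y X) : (pull f a).E ⟶ a.E :=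
  (a.exists_pull f).choose_spec.choose

/-- The canonical map from the middle term of `ξ` to the middle term of `g.ξ`. -/
def pushHom (g : X ⟶ Z) (a : Extension Y X) : a.E ⟶ (push g a).E :=
  (a.exists_push g).choose_spec.choose

@[simp]
lemma i_pullHom (f : Z ⟶ Y) (a : Extension Y X) : (pull f a).i ≫ pullHom f a = a.i :=
  (a.exists_pull f).choose_spec.choose_spec.1

@[simp]
lemma i_pullHom_assoc (f : Z ⟶ Y) (a : Extension Y X) {T : C} (t : a.E ⟶ T) :
    (pull f a).i ≫ pullHom f a ≫ t = a.i ≫ t := by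
  rw [← Category.assoc, i_pullHom]

lemma isPullback_pull (f : Z ⟶ Y) (a : Extension Y X) :
    IsPullback (pullHom f a) (pull f a).d a.d f :=
  (a.exists_pull f).choose_spec.choose_spec.2

@[simp]
lemma pushHom_d (g : X ⟶ Z) (a : Extension Y X) : pushHom g a ≫ (push g a).d = a.d :=
  (a.exists_push g).choose_spec.choose_spec.1

@[simp]
lemma pushHom_d_assoc (g : X ⟶ Z) (a : Extension Y X) {T : C} (t : Y ⟶ T) :
    pushHom g a ≫ (push g a).d ≫ t = a.d ≫ t := by
  rw [← Category.assoc, pushHom_d]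

lemma isPushout_push (g : X ⟶ Z) (a : Extension Y X) :
    IsPushout a.i g (pushHom g a) (push g a).i :=
  (a.exists_push g).choose_spec.choose_spec.2

/-- A morphism of conflations `ξ ⟶ ξ'` with end components `g` and `f` yields an equivalence
between `g.ξ` and `ξ'.f`. -/
lemma push_equivalent_pull {X' Y' : C} (a : Extension Y X) (b : Extension Y' X') (g : X ⟶ X')
    (e : a.E ⟶ b.E) (f : Y ⟶ Y') (h₁ : a.i ≫ e = g ≫ b.i) (h₂ : e ≫ b.d = a.d ≫ f) :
    Equivalent (push g a) (pull f b) := by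
  have hpo := isPushout_push g a
  have hpb := isPullback_pull f b
  let s : a.E ⟶ (pull f b).E := hpb.lift e a.d h₂
  have hs₁ : s ≫ pullHom f b = e := hpb.lift_fst ..
  have hs₂ : s ≫ (pull f b).d = a.d := hpb.lift_snd ..
  have hs : a.i ≫ s = g ≫ (pull f b).i := hpb.hom_ext (by simp [hs₁, h₁])
    (by simp [hs₂, a.w, (pull f b).w])
  refine equivalent_of_hom _ _ (hpo.desc s _ hs) (hpo.inr_desc ..) (hpo.hom_ext ?_ ?_)
  · rw [← Category.assoc, hpo.inl_desc, hs₂, pushHom_d]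
  · rw [← Category.assoc, hpo.inr_desc, (pull f b).w, (push g a).w]

/-- The fibre product over `Y` of two extensions of `Y`: the conflation
`X ⊞ X' ⟶ E ×_Y E' ⟶ Y`. -/
lemma exists_fibreProduct {X' : C} (a : Extension Y X) (b : Extension Y X') :
    ∃ (c : Extension Y (X ⊞ X')) (p : c.E ⟶ a.E) (q : c.E ⟶ b.E),
      IsPullback p q a.d b.d ∧ p ≫ a.d = c.d ∧
      c.i ≫ p = biprod.fst ≫ a.i ∧ c.i ≫ q = biprod.snd ≫ b.i := by
  obtain ⟨P, p, q, hP, hq⟩ := ExactCategory.exists_pullback a.d b.d a.isDeflation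
  have hw : (biprod.fst ≫ a.i : X ⊞ X' ⟶ _) ≫ a.d = (biprod.snd ≫ b.i) ≫ b.d := by
    simp [a.w, b.w]
  let i : X ⊞ X' ⟶ P := hP.lift (biprod.fst ≫ a.i) (biprod.snd ≫ b.i) hw
  have h₁ : i ≫ p = biprod.fst ≫ a.i := hP.lift_fst ..
  have h₂ : i ≫ q = biprod.snd ≫ b.i := hP.lift_snd ..
  have := a.mono_i
  have := b.mono_i
  have hi : Mono i := by
    refine Preadditive.mono_of_cancel_zero _ fun {T} t ht => biprod.hom_ext _ _ ?_ ?_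
    · rw [← cancel_mono a.i, Category.assoc, ← h₁, reassoc_of% ht]; simp
    · rw [← cancel_mono b.i, Category.assoc, ← h₂, reassoc_of% ht]; simp
  refine ⟨⟨P, i, q ≫ b.d, ?_, conflation_of_deflation _ _ _
    (ExactCategory.deflation_comp _ _ hq b.isDeflation) fun t ht => ?_⟩, p, q, hP, hP.w, h₁, h₂⟩
  · rw [← Category.assoc, h₂, Category.assoc, b.w, comp_zero]
  · obtain ⟨s, hs⟩ := a.exists_lift (t ≫ p) (by rw [Category.assoc, hP.w, ht])
    obtain ⟨s', hs'⟩ := b.exists_lift (t ≫ q) (by rw [Category.assoc, ht])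
    exact ⟨biprod.lift s s', hP.hom_ext (by simp [h₁, hs]) (by simp [h₂, hs'])⟩

/-- The fibre product of two extensions of `Y`, as an extension of `Y` by `X ⊞ X'`. -/
def fibreProduct {X' : C} (a : Extension Y X) (b : Extension Y X') : Extension Y (X ⊞ X') :=
  (exists_fibreProduct a b).choose

/-- The first projection `E ×_Y E' ⟶ E`. -/
def fibreFst {X' : C} (a : Extension Y X) (b : Extension Y X') : (fibreProduct a b).E ⟶ a.E :=
  (exists_fibreProduct a b).choose_spec.choose

/-- The second projection `E ×_Y E' ⟶ E'`. -/
def fibreSnd {X' : C} (a : Extension Y X) (b : Extension Y X') : (fibreProduct a b).E ⟶ b.E :=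
  (exists_fibreProduct a b).choose_spec.choose_spec.choose

lemma isPullback_fibreProduct {X' : C} (a : Extension Y X) (b : Extension Y X') :
    IsPullback (fibreFst a b) (fibreSnd a b) a.d b.d :=
  (exists_fibreProduct a b).choose_spec.choose_spec.choose_spec.1

@[simp]
lemma fibreFst_d {X' : C} (a : Extension Y X) (b : Extension Y X') :
    fibreFst a b ≫ a.d = (fibreProduct a b).d :=
  (exists_fibreProduct a b).choose_spec.choose_spec.choose_spec.2.1

@[simp]
lemma fibreFst_d_assoc {X' T : C} (a : Extension Y X) (b : Extension Y X') (t : Y ⟶ T) :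
    fibreFst a b ≫ a.d ≫ t = (fibreProduct a b).d ≫ t := by
  rw [← Category.assoc, fibreFst_d]

@[simp]
lemma fibreSnd_d {X' : C} (a : Extension Y X) (b : Extension Y X') :
    fibreSnd a b ≫ b.d = (fibreProduct a b).d := by
  rw [← (isPullback_fibreProduct a b).w, fibreFst_d]

@[simp]
lemma fibreSnd_d_assoc {X' T : C} (a : Extension Y X) (b : Extension Y X') (t : Y ⟶ T) :
    fibreSnd a b ≫ b.d ≫ t = (fibreProduct a b).d ≫ t := by
  rw [← Category.assoc, fibreSnd_d]

@[simp]
lemma i_fibreFst {X' : C} (a : Extension Y X) (b : Extension Y X') :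
    (fibreProduct a b).i ≫ fibreFst a b = biprod.fst ≫ a.i :=
  (exists_fibreProduct a b).choose_spec.choose_spec.choose_spec.2.2.1

@[simp]
lemma i_fibreFst_assoc {X' T : C} (a : Extension Y X) (b : Extension Y X') (t : a.E ⟶ T) :
    (fibreProduct a b).i ≫ fibreFst a b ≫ t = biprod.fst ≫ a.i ≫ t := by
  rw [← Category.assoc, i_fibreFst, Category.assoc]

@[simp]
lemma i_fibreSnd {X' : C} (a : Extension Y X) (b : Extension Y X') :
    (fibreProduct a b).i ≫ fibreSnd a b = biprod.snd ≫ b.i :=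
  (exists_fibreProduct a b).choose_spec.choose_spec.choose_spec.2.2.2

@[simp]
lemma i_fibreSnd_assoc {X' T : C} (a : Extension Y X) (b : Extension Y X') (t : b.E ⟶ T) :
    (fibreProduct a b).i ≫ fibreSnd a b ≫ t = biprod.snd ≫ b.i ≫ t := by
  rw [← Category.assoc, i_fibreSnd, Category.assoc]

lemma conflation_biprod (X Y : C) :
    ExactCategory.conflation
      (ShortComplex.mk (biprod.inl : X ⟶ X ⊞ Y) (biprod.snd : X ⊞ Y ⟶ Y) biprod.inl_snd) := by
  obtain ⟨O, hO⟩ := HasZeroObject.zero (C := C)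
  let a : Extension O O := ⟨O, 0, 0, by simp, ExactCategory.zero_mem _ hO hO hO⟩
  obtain ⟨b, p, -, hp⟩ := a.exists_push (0 : O ⟶ X)
  obtain ⟨r, hr⟩ : ∃ r : b.E ⟶ X, b.i ≫ r = 𝟙 X :=
    ⟨hp.desc 0 (𝟙 X) (by simp), hp.inr_desc ..⟩
  obtain ⟨c, q, hq, -⟩ := b.exists_pull (0 : Y ⟶ O)
  have hc : c.i ≫ q ≫ r = 𝟙 X := by rw [← Category.assoc, hq, hr]
  obtain ⟨s, hs⟩ := c.exists_desc (𝟙 _ - (q ≫ r) ≫ c.i)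
    (by rw [Preadditive.comp_sub, ← Category.assoc, hc]; simp)
  have := c.epi_d
  have hs₁ : s ≫ c.d = 𝟙 Y := by
    rw [← cancel_epi c.d, ← Category.assoc, hs]; simp [c.w]
  have hs₂ : s ≫ q ≫ r = 0 := by
    rw [← cancel_epi c.d, ← Category.assoc, hs]
    simp only [Preadditive.sub_comp, Category.assoc, hc, Category.id_comp, Category.comp_id,
      sub_self, comp_zero]
  refine ExactCategory.of_iso (ShortComplex.mk c.i c.d c.w) _ ⟨ShortComplex.isoMk (Iso.refl _)
    ⟨biprod.lift (q ≫ r) c.d, biprod.desc c.i s, ?_, ?_⟩ (Iso.refl _) ?_ ?_⟩ c.mem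
  · simp [hs]
  · apply biprod.hom_ext' <;> apply biprod.hom_ext <;> simp [hc, c.w, hs₁, hs₂]
  · apply biprod.hom_ext <;> simp [hc, c.w]
  · simp

/-- The split extension `X ⟶ X ⊞ Y ⟶ Y`. -/
def split (Y X : C) : Extension Y X :=
  ⟨X ⊞ Y, biprod.inl, biprod.snd, biprod.inl_snd, conflation_biprod X Y⟩

end Extension

/-! ### The bifunctor `Ext` -/

variable {X Y Z W : C}

/-- The set `Ext(Y, X)` of equivalence classes of conflations `X ⟶ E ⟶ Y`. -/
def YExt (Y X : C) : Type (max u v) := _root_.Quotient (Extension.setoid Y X)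

namespace YExt

/-- The class of an extension. -/
def mk (a : Extension Y X) : YExt Y X := Quotient.mk _ a

lemma mk_surjective (x : YExt Y X) : ∃ a, mk a = x := Quotient.exists_rep x

lemma mk_eq_iff (a b : Extension Y X) : mk a = mk b ↔ Extension.Equivalent a b := Quotient.eq

lemma mk_eq_of_hom (a b : Extension Y X) (e : a.E ⟶ b.E) (h₁ : a.i ≫ e = b.i)
    (h₂ : e ≫ b.d = a.d) : mk a = mk b :=
  (mk_eq_iff _ _).2 (Extension.equivalent_of_hom a b e h₁ h₂)

lemma mk_pull_id (a : Extension Y X) : mk (a.pull (𝟙 Y)) = mk a :=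
  mk_eq_of_hom _ _ (a.pullHom (𝟙 Y)) (by simp) (by rw [(a.isPullback_pull (𝟙 Y)).w]; simp)

lemma mk_push_id (a : Extension Y X) : mk (a.push (𝟙 X)) = mk a :=
  (mk_eq_of_hom _ _ (a.pushHom (𝟙 X)) (by rw [(a.isPushout_push (𝟙 X)).w]; simp) (by simp)).symm

lemma mk_push_eq_mk_pull {X' Y' : C} (a : Extension Y X) (b : Extension Y' X') (g : X ⟶ X')
    (e : a.E ⟶ b.E) (f : Y ⟶ Y') (h₁ : a.i ≫ e = g ≫ b.i) (h₂ : e ≫ b.d = a.d ≫ f) :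
    mk (a.push g) = mk (b.pull f) :=
  (mk_eq_iff _ _).2 (Extension.push_equivalent_pull a b g e f h₁ h₂)

/-- The pullback operation `ξ ↦ ξ.f` on classes. -/
def pull (f : Z ⟶ Y) : YExt Y X → YExt Z X :=
  Quotient.lift (fun a => mk (a.pull f)) (by
    rintro a b ⟨e, h₁, h₂⟩
    rw [← mk_push_id]
    refine mk_push_eq_mk_pull _ _ _ (a.pullHom f ≫ e.hom) _ ?_ ?_
    · simp [h₁]
    · rw [Category.assoc, h₂, (a.isPullback_pull f).w])

/-- The pushout operation `ξ ↦ g.ξ` on classes. -/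
def push (g : X ⟶ Z) : YExt Y X → YExt Y Z :=
  Quotient.lift (fun a => mk (a.push g)) (by
    rintro a b ⟨e, h₁, h₂⟩
    rw [← mk_pull_id (b.push g)]
    refine mk_push_eq_mk_pull _ _ _ (e.hom ≫ b.pushHom g) _ ?_ ?_
    · rw [reassoc_of% h₁, (b.isPushout_push g).w]
    · simp [h₂])

lemma pull_mk (f : Z ⟶ Y) (a : Extension Y X) : pull f (mk a) = mk (a.pull f) := rfl

lemma push_mk (g : X ⟶ Z) (a : Extension Y X) : push g (mk a) = mk (a.push g) := rfl

/-- A morphism of conflations `ξ ⟶ ξ'` with end components `g` and `f` yields `g.ξ = ξ'.f`. -/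
lemma push_eq_pull {X' Y' : C} (a : Extension Y X) (b : Extension Y' X') (g : X ⟶ X')
    (e : a.E ⟶ b.E) (f : Y ⟶ Y') (h₁ : a.i ≫ e = g ≫ b.i) (h₂ : e ≫ b.d = a.d ≫ f) :
    push g (mk a) = pull f (mk b) :=
  mk_push_eq_mk_pull a b g e f h₁ h₂

@[simp] lemma pull_id (x : YExt Y X) : pull (𝟙 Y) x = x := by
  obtain ⟨a, rfl⟩ := mk_surjective x
  exact mk_pull_id a

@[simp] lemma push_id (x : YExt Y X) : push (𝟙 X) x = x := by
  obtain ⟨a, rfl⟩ := mk_surjective x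
  exact mk_push_id a

lemma push_eq_of_hom {X' : C} (a : Extension Y X) (b : Extension Y X') (g : X ⟶ X')
    (e : a.E ⟶ b.E) (h₁ : a.i ≫ e = g ≫ b.i) (h₂ : e ≫ b.d = a.d) :
    push g (mk a) = mk b := by
  rw [push_eq_pull a b g e (𝟙 _) h₁ (by simp [h₂]), pull_id]

lemma pull_eq_of_hom {Y' : C} (a : Extension Y X) (b : Extension Y' X) (f : Y ⟶ Y')
    (e : a.E ⟶ b.E) (h₁ : a.i ≫ e = b.i) (h₂ : e ≫ b.d = a.d ≫ f) :
    pull f (mk b) = mk a := by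
  rw [← push_eq_pull a b (𝟙 _) e f (by simp [h₁]) h₂, push_id]

lemma pull_comp (f' : W ⟶ Z) (f : Z ⟶ Y) (x : YExt Y X) :
    pull (f' ≫ f) x = pull f' (pull f x) := by
  obtain ⟨a, rfl⟩ := mk_surjective x
  refine pull_eq_of_hom _ _ _ ((a.pull f).pullHom f' ≫ a.pullHom f) (by simp) ?_
  rw [Category.assoc, (a.isPullback_pull f).w, ← Category.assoc,
    ((a.pull f).isPullback_pull f').w, Category.assoc]

lemma push_comp (g : X ⟶ Z) (g' : Z ⟶ W) (x : YExt Y X) :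
    push (g ≫ g') x = push g' (push g x) := by
  obtain ⟨a, rfl⟩ := mk_surjective x
  refine push_eq_of_hom _ _ _ (a.pushHom g ≫ (a.push g).pushHom g') ?_ (by simp)
  rw [← Category.assoc, (a.isPushout_push g).w, Category.assoc,
    ((a.push g).isPushout_push g').w, Category.assoc]

lemma push_pull (g : X ⟶ W) (f : Z ⟶ Y) (x : YExt Y X) :
    push g (pull f x) = pull f (push g x) := by
  obtain ⟨a, rfl⟩ := mk_surjective x
  refine push_eq_pull (a.pull f) (a.push g) g (a.pullHom f ≫ a.pushHom g) f ?_ ?_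
  · rw [← Category.assoc, Extension.i_pullHom, (a.isPushout_push g).w]
  · rw [Category.assoc, Extension.pushHom_d, (a.isPullback_pull f).w]

/-- A representative of a class. -/
def rep (x : YExt Y X) : Extension Y X := Quotient.out x

@[simp] lemma mk_rep (x : YExt Y X) : mk x.rep = x := Quotient.out_eq x

/-- The class in `Ext(Y, X ⊞ X')` with components `x` and `x'`. -/
def pair {X' : C} (x : YExt Y X) (x' : YExt Y X') : YExt Y (X ⊞ X') :=
  mk (x.rep.fibreProduct x'.rep)

lemma push_fst_pair {X' : C} (x : YExt Y X) (x' : YExt Y X') :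
    push biprod.fst (pair x x') = x :=
  (push_eq_of_hom _ x.rep _ (x.rep.fibreFst x'.rep) (by simp) (by simp)).trans (mk_rep x)

lemma push_snd_pair {X' : C} (x : YExt Y X) (x' : YExt Y X') :
    push biprod.snd (pair x x') = x' :=
  (push_eq_of_hom _ x'.rep _ (x.rep.fibreSnd x'.rep) (by simp) (by simp)).trans (mk_rep x')

lemma push_mk_eq_mk_iff {X' : C} (g : X ⟶ X') (a : Extension Y X) (b : Extension Y X') :
    push g (mk a) = mk b ↔ ∃ e : a.E ⟶ b.E, a.i ≫ e = g ≫ b.i ∧ e ≫ b.d = a.d := by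
  refine ⟨fun h => ?_, fun ⟨e, h₁, h₂⟩ => push_eq_of_hom a b g e h₁ h₂⟩
  obtain ⟨e, h₁, h₂⟩ := (mk_eq_iff _ _).1 h
  refine ⟨a.pushHom g ≫ e.hom, ?_, ?_⟩
  · rw [← Category.assoc, (a.isPushout_push g).w, Category.assoc, h₁]
  · rw [Category.assoc, h₂, Extension.pushHom_d]

lemma pull_mk_eq_mk_iff {Y' : C} (f : Y ⟶ Y') (a : Extension Y X) (b : Extension Y' X) :
    pull f (mk b) = mk a ↔ ∃ e : a.E ⟶ b.E, a.i ≫ e = b.i ∧ e ≫ b.d = a.d ≫ f := by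
  refine ⟨fun h => ?_, fun ⟨e, h₁, h₂⟩ => pull_eq_of_hom a b f e h₁ h₂⟩
  obtain ⟨e, h₁, h₂⟩ := (mk_eq_iff _ _).1 h
  refine ⟨e.inv ≫ b.pullHom f, ?_, ?_⟩
  · rw [← h₁]; simp
  · rw [Category.assoc, (b.isPullback_pull f).w, ← h₂]; simp

lemma push_lift {X' : C} (g : Z ⟶ X) (g' : Z ⟶ X') (x : YExt Y Z) :
    push (biprod.lift g g') x = pair (push g x) (push g' x) := by
  obtain ⟨a, rfl⟩ := mk_surjective x
  obtain ⟨e, h₁, h₂⟩ := (push_mk_eq_mk_iff g a _).1 (mk_rep (push g (mk a))).symm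
  obtain ⟨e', h₁', h₂'⟩ := (push_mk_eq_mk_iff g' a _).1 (mk_rep (push g' (mk a))).symm
  have h := (push g (mk a)).rep.isPullback_fibreProduct (push g' (mk a)).rep
  refine push_eq_of_hom _ _ _ (h.lift e e' (by rw [h₂, h₂'])) (h.hom_ext ?_ ?_) ?_
  · simp [h₁]
  · simp [h₁']
  · rw [← Extension.fibreFst_d, h.lift_fst_assoc, h₂]

/-- The Baer sum of `x` and `x'`: the pushout of their fibre product along the codiagonal. -/
instance : Add (YExt Y X) where
  add x x' := push (biprod.desc (𝟙 X) (𝟙 X)) (pair x x')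

/-- The zero element of `Ext(Y, X)` is the class of the split extension. -/
instance : Zero (YExt Y X) where
  zero := mk (Extension.split Y X)

instance : Neg (YExt Y X) where
  neg x := push (-𝟙 X) x

lemma add_def (x x' : YExt Y X) :
    x + x' = push (biprod.desc (𝟙 X) (𝟙 X)) (pair x x') := rfl

lemma zero_def : (0 : YExt Y X) = mk (Extension.split Y X) := rfl

lemma neg_def (x : YExt Y X) : -x = push (-𝟙 X) x := rfl

lemma add_push (g g' : X ⟶ Z) (x : YExt Y X) : push (g + g') x = push g x + push g' x := by
  rw [add_def, ← push_lift, ← push_comp]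
  congr 1
  simp

lemma push_add (g : X ⟶ Z) (x x' : YExt Y X) : push g (x + x') = push g x + push g x' := by
  have : biprod.desc (𝟙 X) (𝟙 X) ≫ g = biprod.fst ≫ g + biprod.snd ≫ g := by
    apply biprod.hom_ext' <;> simp
  rw [add_def, ← push_comp, this, add_push, push_comp, push_comp, push_fst_pair, push_snd_pair]

lemma pull_add (f : Z ⟶ Y) (x x' : YExt Y X) : pull f (x + x') = pull f x + pull f x' := by
  have : biprod.desc (𝟙 X) (𝟙 X) = biprod.fst + biprod.snd := by
    apply biprod.hom_ext' <;> simp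
  rw [add_def, ← push_pull, this, add_push, push_pull, push_pull, push_fst_pair, push_snd_pair]

lemma add_pull (f f' : Z ⟶ Y) (x : YExt Y X) : pull (f + f') x = pull f x + pull f' x := by
  obtain ⟨a, rfl⟩ := mk_surjective x
  obtain ⟨e, h₁, h₂⟩ := (pull_mk_eq_mk_iff f _ a).1 (mk_rep (pull f (mk a))).symm
  obtain ⟨e', h₁', h₂'⟩ := (pull_mk_eq_mk_iff f' _ a).1 (mk_rep (pull f' (mk a))).symm
  refine (push_eq_pull _ a _ (Extension.fibreFst _ _ ≫ e + Extension.fibreSnd _ _ ≫ e') _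
    ?_ ?_).symm
  · simp only [Preadditive.comp_add, Extension.i_fibreFst_assoc, Extension.i_fibreSnd_assoc, h₁,
      h₁', ← Preadditive.add_comp]
    congr 1
    apply biprod.hom_ext' <;> simp
  · simp [h₂, h₂']

@[simp] lemma zero_push (x : YExt Y X) : push (0 : X ⟶ Z) x = 0 := by
  obtain ⟨a, rfl⟩ := mk_surjective x
  refine push_eq_of_hom a (Extension.split Y Z) 0 (a.d ≫ (biprod.inr : Y ⟶ Z ⊞ Y)) ?_ ?_
  · change a.i ≫ a.d ≫ (biprod.inr : Y ⟶ Z ⊞ Y) = 0 ≫ biprod.inl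
    rw [← Category.assoc, a.w, zero_comp, zero_comp]
  · change (a.d ≫ (biprod.inr : Y ⟶ Z ⊞ Y)) ≫ biprod.snd = a.d
    simp

lemma push_eq_zero_iff (g : X ⟶ Z) (a : Extension Y X) :
    push g (mk a) = 0 ↔ ∃ h : a.E ⟶ Z, a.i ≫ h = g := by
  rw [zero_def, push_mk_eq_mk_iff]
  change (∃ e : a.E ⟶ Z ⊞ Y, a.i ≫ e = g ≫ biprod.inl ∧ e ≫ biprod.snd = a.d) ↔ _
  constructor
  · rintro ⟨e, h₁, -⟩
    exact ⟨e ≫ biprod.fst, by rw [← Category.assoc, h₁]; simp⟩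
  · rintro ⟨h, rfl⟩
    refine ⟨biprod.lift h a.d, ?_, by simp⟩
    apply biprod.hom_ext <;> simp [a.w]

lemma pull_eq_zero_iff (f : Z ⟶ Y) (a : Extension Y X) :
    pull f (mk a) = 0 ↔ ∃ h : Z ⟶ a.E, h ≫ a.d = f := by
  rw [zero_def, pull_mk_eq_mk_iff]
  change (∃ e : X ⊞ Z ⟶ a.E, biprod.inl ≫ e = a.i ∧ e ≫ a.d = biprod.snd ≫ f) ↔ _
  constructor
  · rintro ⟨e, -, h₂⟩
    exact ⟨biprod.inr ≫ e, by rw [Category.assoc, h₂]; simp⟩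
  · rintro ⟨h, rfl⟩
    refine ⟨biprod.desc a.i h, by simp, ?_⟩
    apply biprod.hom_ext' <;> simp [a.w]

@[simp] lemma zero_pull (x : YExt Y X) : pull (0 : Z ⟶ Y) x = 0 := by
  obtain ⟨a, rfl⟩ := mk_surjective x
  exact (pull_eq_zero_iff 0 a).2 ⟨0, by simp⟩

instance : AddCommGroup (YExt Y X) where
  add_assoc x y z := by
    have hx := push_fst_pair x (pair y z)
    have h := push_snd_pair x (pair y z)
    have hy := push_fst_pair y z
    have hz := push_snd_pair y z
    rw [← h, ← push_comp] at hy hz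
    generalize pair x (pair y z) = t at *
    rw [← hx, ← hy, ← hz, ← add_push, ← add_push, ← add_push, ← add_push, add_assoc]
  add_comm x y := by
    have hx := push_fst_pair x y
    have hy := push_snd_pair x y
    generalize pair x y = t at *
    rw [← hx, ← hy, ← add_push, ← add_push, add_comm]
  zero_add x := by
    conv_rhs => rw [← push_id x, ← zero_add (𝟙 X), add_push, zero_push, push_id]
  add_zero x := by
    conv_rhs => rw [← push_id x, ← add_zero (𝟙 X), add_push, zero_push, push_id]
  neg_add_cancel x := by
    conv_lhs => rw [neg_def, ← push_id x, ← push_comp, ← add_push]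
    simp
  nsmul := nsmulRec
  zsmul := zsmulRec

/-- `Ext(Y, g)` as a homomorphism. -/
def pushHom (g : X ⟶ Z) : YExt Y X →+ YExt Y Z := AddMonoidHom.mk' (push g) (push_add g)

/-- `Ext(f, X)` as a homomorphism. -/
def pullHom (f : Z ⟶ Y) : YExt Y X →+ YExt Z X := AddMonoidHom.mk' (pull f) (pull_add f)

end YExt

/-- A morphism `f : Y ⟶ Y'` is projectively trivial if `Ext(f, Z) = 0` for every object `Z`. -/
def IsProjTrivial {Y Y' : C} (f : Y ⟶ Y') : Prop :=
  ∀ (Z : C) (x : YExt Y' Z), YExt.pull f x = 0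

/-- A morphism `f : X ⟶ X'` is injectively trivial if `Ext(Z, f) = 0` for every object `Z`. -/
def IsInjTrivial {X X' : C} (f : X ⟶ X') : Prop :=
  ∀ (Z : C) (x : YExt Z X), YExt.push f x = 0

variable (C) in
/-- The congruence defining `C / I`. -/
def injRel : HomRel C := fun _ _ f g => IsInjTrivial (f - g)

variable (C) in
/-- The congruence defining `C / P`. -/
def projRel : HomRel C := fun _ _ f g => IsProjTrivial (f - g)

instance : Congruence (injRel C) where
  equivalence :=
    { refl := fun f Z x => by simp
      symm := fun {f g} h Z x => by
        have := YExt.add_push (f - g) (g - f) x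
        rwa [h Z x, zero_add, sub_add_sub_cancel, sub_self, YExt.zero_push, eq_comm] at this
      trans := fun {f g l} h h' Z x => by
        rw [← sub_add_sub_cancel f g l, YExt.add_push, h Z x, h' Z x, add_zero] }
  comp_left f g g' h Z x := by rw [← Preadditive.comp_sub, YExt.push_comp, h]
  comp_right {X Y Z f f'} g h T x := by
    rw [← Preadditive.sub_comp, YExt.push_comp, h]
    exact (YExt.pushHom g).map_zero

instance : Congruence (projRel C) where
  equivalence :=
    { refl := fun f Z x => by simp
      symm := fun {f g} h Z x => by
        have := YExt.add_pull (f - g) (g - f) x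
        rwa [h Z x, zero_add, sub_add_sub_cancel, sub_self, YExt.zero_pull, eq_comm] at this
      trans := fun {f g l} h h' Z x => by
        rw [← sub_add_sub_cancel f g l, YExt.add_pull, h Z x, h' Z x, add_zero] }
  comp_left f g g' h Z x := by
    rw [← Preadditive.comp_sub, YExt.pull_comp, h]
    exact (YExt.pullHom f).map_zero
  comp_right {X Y Z f f'} g h T x := by rw [← Preadditive.sub_comp, YExt.pull_comp, h]

variable (C) in
/-- The quotient `C / I` of `C` by the ideal of injectively trivial morphisms. -/
abbrev InjStable : Type u := CategoryTheory.Quotient (injRel C)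

variable (C) in
/-- The quotient `C / P` of `C` by the ideal of projectively trivial morphisms. -/
abbrev ProjStable : Type u := CategoryTheory.Quotient (projRel C)

instance : Preadditive (InjStable C) :=
  CategoryTheory.Quotient.preadditive _ fun X Y f₁ f₂ g₁ g₂ h h' Z x => by
    rw [add_sub_add_comm, YExt.add_push, h, h', add_zero]

instance : (CategoryTheory.Quotient.functor (injRel C)).Additive :=
  CategoryTheory.Quotient.functor_additive _ _

instance : Preadditive (ProjStable C) :=
  CategoryTheory.Quotient.preadditive _ fun X Y f₁ f₂ g₁ g₂ h h' Z x => by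
    rw [add_sub_add_comm, YExt.add_pull, h, h', add_zero]

instance : (CategoryTheory.Quotient.functor (projRel C)).Additive :=
  CategoryTheory.Quotient.functor_additive _ _

lemma IsInjTrivial.exists_factor (ξ : Conflation C) {K : C} {g : ξ.obj.X₁ ⟶ K}
    (hg : IsInjTrivial g) : ∃ h : ξ.obj.X₂ ⟶ K, ξ.obj.f ≫ h = g :=
  (YExt.push_eq_zero_iff g (Extension.ofConflation ξ)).1 (hg _ _)

lemma IsProjTrivial.exists_factor (ξ : Conflation C) {K : C} {g : K ⟶ ξ.obj.X₃}
    (hg : IsProjTrivial g) : ∃ h : K ⟶ ξ.obj.X₂, h ≫ ξ.obj.g = g :=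
  (YExt.pull_eq_zero_iff g (Extension.ofConflation ξ)).1 (hg _ _)

lemma IsInjTrivial.comp_left {f : X ⟶ Y} {g : Y ⟶ Z} (hg : IsInjTrivial g) :
    IsInjTrivial (f ≫ g) := fun T x => by rw [YExt.push_comp, hg]

lemma IsProjTrivial.comp_right {f : X ⟶ Y} {g : Y ⟶ Z} (hf : IsProjTrivial f) :
    IsProjTrivial (f ≫ g) := fun T x => by rw [YExt.pull_comp, hf]

end ExactCategory

section Linear

variable (k : Type w) [CommRing k]
variable {C : Type u} [Category.{v} C] [Preadditive C] [Linear k C] [HasFiniteBiproducts C]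
  [ExactCategory C] {X Y Z W : C}

namespace YExt

/-- The `k`-module structure on `Ext(Y, X)`, with `a • ξ = (a • 𝟙).ξ`. -/
instance : Module k (YExt Y X) where
  smul a x := push (a • 𝟙 X) x
  one_smul x := by
    change push ((1 : k) • 𝟙 X) x = x
    simp
  mul_smul a b x := by
    change push ((a * b) • 𝟙 X) x = push (a • 𝟙 X) (push (b • 𝟙 X) x)
    rw [← push_comp]
    simp [smul_smul]
  smul_zero a := by
    change push (a • 𝟙 X) (0 : YExt Y X) = 0
    rw [← zero_push (0 : YExt Y X), ← push_comp]
    simp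
  smul_add a x y := push_add _ x y
  add_smul a b x := by
    change push ((a + b) • 𝟙 X) x = push (a • 𝟙 X) x + push (b • 𝟙 X) x
    rw [add_smul, add_push]
  zero_smul x := by
    change push ((0 : k) • 𝟙 X) x = 0
    simp

lemma smul_def (a : k) (x : YExt Y X) : a • x = push (a • 𝟙 X) x := rfl

/-- `Ext(Y, g)` as a linear map. -/
@[simps]
def pushₗ (g : X ⟶ Z) : YExt Y X →ₗ[k] YExt Y Z where
  toFun := push g
  map_add' := push_add g
  map_smul' a x := by simp [smul_def, ← push_comp]

/-- `Ext(f, X)` as a linear map. -/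
@[simps]
def pullₗ (f : Z ⟶ Y) : YExt Y X →ₗ[k] YExt Z X where
  toFun := pull f
  map_add' := pull_add f
  map_smul' a x := by simp [smul_def, push_pull]

end YExt

instance : Linear k (InjStable C) :=
  CategoryTheory.Quotient.linear k _ fun a X Y f₁ f₂ h Z x => by
    rw [← smul_sub, ← Category.comp_id (a • (f₁ - f₂)), Linear.smul_comp, ← Linear.comp_smul,
      YExt.push_comp, h]
    exact (YExt.pushHom _).map_zero

instance : Linear k (ProjStable C) :=
  CategoryTheory.Quotient.linear k _ fun a X Y f₁ f₂ h Z x => by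
    rw [← smul_sub, ← Category.comp_id (a • (f₁ - f₂)), Linear.smul_comp, ← Linear.comp_smul,
      YExt.pull_comp]
    exact h _ _

/-! ### The defects of a conflation -/

/-- The covariant defect of a conflation `X ⟶ E ⟶ Y` at `K`: the cokernel of
`Hom(E, K) ⟶ Hom(X, K)`. -/
abbrev CovDefect (ξ : Conflation C) (K : C) : Type v :=
  (ξ.obj.X₁ ⟶ K) ⧸ LinearMap.range (Linear.leftComp k K ξ.obj.f)

/-- The contravariant defect of a conflation `X ⟶ E ⟶ Y` at `K`: the cokernel of
`Hom(K, E) ⟶ Hom(K, Y)`. -/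
abbrev ContraDefect (ξ : Conflation C) (K : C) : Type v :=
  (K ⟶ ξ.obj.X₃) ⧸ LinearMap.range (Linear.rightComp k K ξ.obj.g)

/-- Functoriality of the covariant defect in the object. -/
def covDefectMap (ξ : Conflation C) {K K' : C} (f : K ⟶ K') :
    CovDefect k ξ K →ₗ[k] CovDefect k ξ K' :=
  Submodule.mapQ _ _ (Linear.rightComp k _ f) (by
    rintro _ ⟨h, rfl⟩
    exact ⟨h ≫ f, by simp⟩)

/-- Functoriality of the covariant defect in the conflation. -/
def covDefectMapConf {ξ ξ' : Conflation C} (m : ξ ⟶ ξ') (K : C) :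
    CovDefect k ξ' K →ₗ[k] CovDefect k ξ K :=
  Submodule.mapQ _ _ (Linear.leftComp k K m.hom.τ₁) (by
    rintro _ ⟨h, rfl⟩
    exact ⟨m.hom.τ₂ ≫ h, by simp [m.hom.comm₁₂_assoc]⟩)

/-- Functoriality of the contravariant defect in the object. -/
def contraDefectMap (ξ : Conflation C) {K K' : C} (f : K ⟶ K') :
    ContraDefect k ξ K' →ₗ[k] ContraDefect k ξ K :=
  Submodule.mapQ _ _ (Linear.leftComp k _ f) (by
    rintro _ ⟨h, rfl⟩
    exact ⟨f ≫ h, by simp⟩)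

/-- Functoriality of the contravariant defect in the conflation. -/
def contraDefectMapConf {ξ ξ' : Conflation C} (m : ξ ⟶ ξ') (K : C) :
    ContraDefect k ξ K →ₗ[k] ContraDefect k ξ' K :=
  Submodule.mapQ _ _ (Linear.rightComp k K m.hom.τ₃) (by
    rintro _ ⟨h, rfl⟩
    exact ⟨h ≫ m.hom.τ₂, by simp [m.hom.comm₂₃]⟩)

lemma hom_ext_of_mk {M : Type v} [AddCommGroup M] [Module k M] {N : Submodule k M}
    {P : ModuleCat.{v} k} {f g : ModuleCat.of k (M ⧸ N) ⟶ P}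
    (h : ∀ m : M, f.hom (Submodule.Quotient.mk m) = g.hom (Submodule.Quotient.mk m)) : f = g :=
  ModuleCat.hom_ext (Submodule.linearMap_qext _ (LinearMap.ext h))

/-- The covariant defect `ξ_*` as a functor on `C`. -/
def preCovDefect (ξ : Conflation C) : C ⥤ ModuleCat.{v} k where
  obj K := ModuleCat.of k (CovDefect k ξ K)
  map f := ModuleCat.ofHom (covDefectMap k ξ f)
  map_id _ := hom_ext_of_mk k fun g => congrArg Submodule.Quotient.mk (Category.comp_id g)
  map_comp f f' := hom_ext_of_mk k fun g =>
    congrArg Submodule.Quotient.mk (Category.assoc g f f').symm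

/-- The covariant defect `ξ_*` as a functor on `C / I`. -/
def covDefectObj (ξ : Conflation C) : InjStable C ⥤ ModuleCat.{v} k :=
  CategoryTheory.Quotient.lift (injRel C) (preCovDefect k ξ) fun _ _ _ _ h =>
    hom_ext_of_mk k fun g => (Submodule.Quotient.eq _).2 <| by
      obtain ⟨l, hl⟩ := IsInjTrivial.exists_factor ξ (IsInjTrivial.comp_left (f := g) h)
      exact ⟨l, by simpa using hl⟩

variable (C) in
/-- The covariant defect as a functor `ξ ↦ ξ_*`. -/
def covDefect : (Conflation C)ᵒᵖ ⥤ InjStable C ⥤ ModuleCat.{v} k where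
  obj ξ := covDefectObj k ξ.unop
  map m :=
    { app := fun K => ModuleCat.ofHom (covDefectMapConf k m.unop K.as)
      naturality := by
        rintro ⟨K⟩ ⟨K'⟩ ⟨f⟩
        exact hom_ext_of_mk k fun g =>
          congrArg Submodule.Quotient.mk (Category.assoc m.unop.hom.τ₁ g f).symm }
  map_id ξ := by
    ext1; ext1 ⟨K⟩
    exact hom_ext_of_mk k fun g => congrArg Submodule.Quotient.mk (Category.id_comp g)
  map_comp m m' := by
    ext1; ext1 ⟨K⟩
    exact hom_ext_of_mk k fun g =>
      congrArg Submodule.Quotient.mk (Category.assoc m'.unop.hom.τ₁ m.unop.hom.τ₁ g)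

/-- The contravariant defect `ξ^*` as a contravariant functor on `C`. -/
def preContraDefect (ξ : Conflation C) : C ⥤ (ModuleCat.{v} k)ᵒᵖ where
  obj K := op (ModuleCat.of k (ContraDefect k ξ K))
  map f := (ModuleCat.ofHom (contraDefectMap k ξ f)).op
  map_id _ := Quiver.Hom.unop_inj <|
    hom_ext_of_mk k fun g => congrArg Submodule.Quotient.mk (Category.id_comp g)
  map_comp f f' := Quiver.Hom.unop_inj <|
    hom_ext_of_mk k fun g => congrArg Submodule.Quotient.mk (Category.assoc f f' g)

/-- The contravariant defect `ξ^*` as a functor on `C / P`. -/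
def contraDefectObj (ξ : Conflation C) : (ProjStable C)ᵒᵖ ⥤ ModuleCat.{v} k :=
  (CategoryTheory.Quotient.lift (projRel C) (preContraDefect k ξ) fun _ _ _ _ h =>
    Quiver.Hom.unop_inj <| hom_ext_of_mk k fun g => (Submodule.Quotient.eq _).2 <| by
      obtain ⟨l, hl⟩ := IsProjTrivial.exists_factor ξ (IsProjTrivial.comp_right (g := g) h)
      exact ⟨l, by simpa using hl⟩).leftOp

variable (C) in
/-- The contravariant defect as a functor `ξ ↦ ξ^*`. -/
def contraDefect : Conflation C ⥤ (ProjStable C)ᵒᵖ ⥤ ModuleCat.{v} k where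
  obj ξ := contraDefectObj k ξ
  map m :=
    { app := fun K => ModuleCat.ofHom (contraDefectMapConf k m K.unop.as)
      naturality := by
        rintro ⟨⟨K⟩⟩ ⟨⟨K'⟩⟩ ⟨⟨f⟩⟩
        exact hom_ext_of_mk k fun g =>
          congrArg Submodule.Quotient.mk (Category.assoc f g m.hom.τ₃) }
  map_id ξ := by
    ext1; ext1 ⟨⟨K⟩⟩
    exact hom_ext_of_mk k fun g => congrArg Submodule.Quotient.mk (Category.comp_id g)
  map_comp m m' := by
    ext1; ext1 ⟨⟨K⟩⟩
    exact hom_ext_of_mk k fun g =>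
      congrArg Submodule.Quotient.mk (Category.assoc g m.hom.τ₃ m'.hom.τ₃).symm

/-! ### Matlis duality -/

/-- `J` is an injective cogenerator: it is injective, and every nonzero element of a module is
detected by a map to `J`. -/
structure IsInjectiveCogenerator (J : Type w) [AddCommGroup J] [Module k J] : Prop where
  injective : Module.Injective k J
  cogenerator : ∀ (M : Type w) [AddCommGroup M] [Module k M] (m : M), m ≠ 0 →
    ∃ f : M →ₗ[k] J, f m ≠ 0

/-- `J` is a minimal injective cogenerator: no proper submodule is an injective cogenerator. -/
structure IsMinimalInjectiveCogenerator (J : Type w) [AddCommGroup J] [Module k J] : Prop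
    extends IsInjectiveCogenerator k J where
  minimal : ∀ N : Submodule k J, IsInjectiveCogenerator k N → N = ⊤

variable (J : Type w) [AddCommGroup J] [Module k J]

/-- The duality functor `D = Hom_k(-, J)`. -/
def matlisDual : (ModuleCat.{v} k)ᵒᵖ ⥤ ModuleCat.{max v w} k where
  obj M := ModuleCat.of k (M.unop →ₗ[k] J)
  map f := ModuleCat.ofHom (LinearMap.lcomp k J f.unop.hom)

/-! ### Generalized Auslander-Reiten duality -/

/-- The functor `Ext(X, -)` on `C / I`. -/
def extObj (X : C) : InjStable C ⥤ ModuleCat.{max u v} k :=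
  CategoryTheory.Quotient.lift (injRel C)
    { obj := fun Z => ModuleCat.of k (YExt X Z)
      map := fun g => ModuleCat.ofHom (YExt.pushₗ k g)
      map_id := fun Z => by ext x; simp
      map_comp := fun g g' => by ext x; simp [YExt.push_comp] }
    (fun Z Z' g g' h => by
      ext x
      have := YExt.add_push (g - g') g' x
      rw [h X x, zero_add, sub_add_cancel] at this
      simpa using this)

/-- The map `Ext(X', -) ⟶ Ext(X, -)` induced by `f : X ⟶ X'`. -/
def extMap {X X' : C} (f : X ⟶ X') : extObj k X' ⟶ extObj k X :=
  CategoryTheory.Quotient.natTransLift _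
    { app := fun Z => ModuleCat.ofHom (YExt.pullₗ k f)
      naturality := fun Z Z' g => by
        ext x
        exact (YExt.push_pull g f x).symm }

variable (C) in
/-- The bifunctor `D Ext(X, Z)`, covariant in `X` in `C / P` and contravariant in `Z` in
`C / I`. -/
def dExt : ProjStable C ⥤ (InjStable C)ᵒᵖ ⥤ ModuleCat.{max u v w} k :=
  CategoryTheory.Quotient.lift (projRel C)
    { obj := fun X => (extObj k X).op ⋙ matlisDual k J
      map := fun f => Functor.whiskerRight (NatTrans.op (extMap k f)) (matlisDual k J)
      map_id := fun X => by
        ext ⟨⟨Z⟩⟩ φ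
        refine LinearMap.ext fun x => ?_
        exact congrArg (fun y : YExt _ Z => (show YExt _ Z →ₗ[k] J from φ) y) (YExt.pull_id x)
      map_comp := fun f f' => by
        ext ⟨⟨Z⟩⟩ φ
        refine LinearMap.ext fun x => ?_
        exact congrArg (fun y : YExt _ Z => (show YExt _ Z →ₗ[k] J from φ) y) (YExt.pull_comp f f' x) }
    (fun X X' f f' h => by
      ext ⟨⟨Z⟩⟩ φ
      refine LinearMap.ext fun x => ?_
      have := YExt.add_pull (f - f') f' x
      rw [h Z x, zero_add, sub_add_cancel] at this
      exact congrArg (fun y : YExt _ Z => (show YExt _ Z →ₗ[k] J from φ) y) this)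

section Representations

universe v₁ u₁ v₂ u₂ x

variable {A : Type u₁} [Category.{v₁} A] {B : Type u₂} [Category.{v₂} B] [Preadditive B]
  [Linear k B]

/-- A `k`-linear representation of a contravariant functor: an object `T` and a natural
isomorphism `Hom(-, T) ≃ F`. -/
structure Representation (F : Bᵒᵖ ⥤ ModuleCat.{x} k) where
  obj : B
  iso : ∀ Z : B, (Z ⟶ obj) ≃ₗ[k] F.obj (op Z)
  natural : ∀ {Z Z' : B} (f : Z' ⟶ Z) (g : Z ⟶ obj),
    iso Z' (f ≫ g) = (F.map f.op).hom (iso Z g)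

/-- A `k`-linear representation of a covariant functor: an object `T` and a natural
isomorphism `Hom(T, -) ≃ F`. -/
structure Corepresentation (F : B ⥤ ModuleCat.{x} k) where
  obj : B
  iso : ∀ Z : B, (obj ⟶ Z) ≃ₗ[k] F.obj Z
  natural : ∀ {Z Z' : B} (f : Z ⟶ Z') (g : obj ⟶ Z),
    iso Z' (g ≫ f) = (F.map f).hom (iso Z g)

/-- If `r a` is a representation of `F(a, -)` for every `a`, then `a ↦ (r a).obj` is a functor in
such a way that the isomorphisms `Hom(-, (r a).obj) ≃ F(a, -)` are natural in `a`. -/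
def representingFunctor (F : A ⥤ Bᵒᵖ ⥤ ModuleCat.{x} k) (r : ∀ a, Representation k (F.obj a)) :
    A ⥤ B where
  obj a := (r a).obj
  map {a a'} f := ((r a').iso _).symm
    (((F.map f).app (op (r a).obj)).hom ((r a).iso _ (𝟙 (r a).obj)))
  map_id a := by simp
  map_comp {a a' a''} f f' := by
    have h : ∀ {b b' : A} (f : b ⟶ b') {Z : B} (g : Z ⟶ (r b).obj),
        (F.map f).app (op Z) ((r b).iso Z g) =
          (F.obj b').map g.op ((F.map f).app _ ((r b).iso _ (𝟙 _))) := fun {b b'} f {Z} g => by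
      rw [← NatTrans.naturality_apply]
      congr 1
      simpa using (r b).natural g (𝟙 _)
    rw [LinearEquiv.symm_apply_eq, (r a'').natural, LinearEquiv.apply_symm_apply]
    refine Eq.trans ?_ (h f' _)
    rw [LinearEquiv.apply_symm_apply]
    simp

/-- If `r b` is a representation of `F(b, -)` for every `b`, then `b ↦ (r b).obj` is a functor in
such a way that the isomorphisms `Hom((r b).obj, -) ≃ F(b, -)` are natural in `b`. -/
def corepresentingFunctor (F : Aᵒᵖ ⥤ B ⥤ ModuleCat.{x} k)
    (r : ∀ a : A, Corepresentation k (F.obj (op a))) : A ⥤ B where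
  obj a := (r a).obj
  map {a a'} f := ((r a).iso _).symm
    (((F.map f.op).app (r a').obj).hom ((r a').iso _ (𝟙 (r a').obj)))
  map_id a := by simp
  map_comp {a a' a''} f f' := by
    have h : ∀ {b b' : A} (f : b ⟶ b') {Z : B} (g : (r b').obj ⟶ Z),
        (F.map f.op).app Z ((r b').iso Z g) =
          (F.obj (op b)).map g ((F.map f.op).app _ ((r b').iso _ (𝟙 _))) := fun {b b'} f {Z} g => by
      rw [← NatTrans.naturality_apply]
      congr 1
      simpa using (r b').natural g (𝟙 _)
    rw [LinearEquiv.symm_apply_eq, (r a).natural, LinearEquiv.apply_symm_apply]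
    refine Eq.trans ?_ (h f _)
    rw [LinearEquiv.apply_symm_apply]
    simp

end Representations

variable (C) in
/-- The full subcategory `C_r` of objects `X` such that `D Ext(X, -)` is representable. -/
def Cr : ObjectProperty C :=
  fun X => Nonempty (Representation k ((dExt k C J).obj ⟨X⟩))

variable (C) in
/-- The full subcategory `C_l` of objects `X` such that `D Ext(-, X)` is representable. -/
def Cl : ObjectProperty C :=
  fun X => Nonempty (Corepresentation k ((dExt k C J).flip.obj (op ⟨X⟩)))

variable (C) in
/-- The image of `C_r` in `C / P`. -/
abbrev StableCr : Type u :=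
  ObjectProperty.FullSubcategory (fun X : ProjStable C => Cr k C J X.as)

variable (C) in
/-- The image of `C_l` in `C / I`. -/
abbrev StableCl : Type u :=
  ObjectProperty.FullSubcategory (fun X : InjStable C => Cl k C J X.as)

variable (C) in
/-- The functor `τ` on the image of `C_r` in `C / P`: the object `τ K` represents `D Ext(K, -)`,
naturally in `K`. -/
def tau : StableCr k C J ⥤ InjStable C :=
  representingFunctor k (ObjectProperty.ι _ ⋙ dExt k C J) (fun K => K.property.some)

variable (C) in
/-- The functor `τ⁻` on the image of `C_l` in `C / I`: the object `τ⁻ K` represents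
`D Ext(-, K)`, naturally in `K`. -/
def tauInv : StableCl k C J ⥤ ProjStable C :=
  corepresentingFunctor k ((ObjectProperty.ι _).op ⋙ (dExt k C J).flip)
    (fun K => K.property.some)

end Linear

end AuslanderDefect
end

open AuslanderDefect

/-!
A conflation `ξ : X ⟶ E ⟶ Y` embeds its contravariant defect `ξ^*(K)` into `Ext(K, X)` as the
kernel of `Ext(K, X) ⟶ Ext(K, E)`. The functor `D` is exact, so `D ξ^*(K)` is the cokernel of
`D Ext(K, E) ⟶ D Ext(K, X)`. If `T` represents `D Ext(K, -)` on `C / I`, then `Hom(-, T)` maps onto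
`D Ext(K, -)` with kernel the injectively trivial morphisms. These factor through every inflation
out of their source, so that the cokernel in question is also the cokernel `ξ_*(T)` of
`Hom(E, T) ⟶ Hom(X, T)`. The second formula is dual.
-/

noncomputable section

namespace AuslanderDefect

section Modules

variable {R : Type*} [CommRing R] {M N P A B J : Type*} [AddCommGroup M] [Module R M]
  [AddCommGroup N] [Module R N] [AddCommGroup P] [Module R P]
  [AddCommGroup A] [Module R A] [AddCommGroup B] [Module R B] [AddCommGroup J] [Module R J]

lemma exact_lcomp_of_baer (hJ : Module.Baer R J) {f : M →ₗ[R] N} {g : N →ₗ[R] P}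
    (hfg : Function.Exact f g) :
    Function.Exact (LinearMap.lcomp R J g) (LinearMap.lcomp R J f) := by
  refine fun φ => ⟨fun hφ => ?_, ?_⟩
  · have hker : LinearMap.ker g ≤ LinearMap.ker φ := by
      rw [hfg.linearMap_ker_eq]
      rintro _ ⟨m, rfl⟩
      exact LinearMap.congr_fun hφ m
    have hinj : Function.Injective ((LinearMap.ker g).liftQ g le_rfl) :=
      LinearMap.ker_eq_bot.1 (Submodule.ker_liftQ_eq_bot _ _ _ le_rfl)
    obtain ⟨ψ, hψ⟩ := hJ.extension_property _ hinj ((LinearMap.ker g).liftQ φ hker)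
    exact ⟨ψ, LinearMap.ext fun n => LinearMap.congr_fun hψ (Submodule.Quotient.mk n)⟩
  · rintro ⟨ψ, rfl⟩
    exact LinearMap.ext fun m => (congrArg ψ (hfg.apply_apply_eq_zero m)).trans ψ.map_zero

lemma exact_comp_of_comm_sq {i : A →ₗ[R] B} {α : A →ₗ[R] M} {β : B →ₗ[R] N} {f : M →ₗ[R] N}
    {g : N →ₗ[R] P} (hfg : Function.Exact f g) (comm : β ∘ₗ i = f ∘ₗ α)
    (hα : Function.Surjective α) (hβ : LinearMap.ker β ≤ LinearMap.range i) :
    Function.Exact i (g ∘ₗ β) := by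
  have comm_apply (a : A) : β (i a) = f (α a) := LinearMap.congr_fun comm a
  refine fun b => ⟨fun hb => ?_, ?_⟩
  · obtain ⟨m, hm⟩ := (hfg (β b)).1 hb
    obtain ⟨a, rfl⟩ := hα m
    have hdiff : b - i a ∈ LinearMap.ker β := by
      rw [LinearMap.mem_ker, map_sub, comm_apply, hm, sub_self]
    exact (Submodule.sub_mem_iff_left _ (LinearMap.mem_range_self i a)).1 (hβ hdiff)
  · rintro ⟨a, rfl⟩
    rw [LinearMap.comp_apply, comm_apply, hfg.apply_apply_eq_zero]

end Modules

section ExactSequences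

variable (k : Type w) [CommRing k] {C : Type u} [Category.{v} C] [Preadditive C] [Linear k C]
  [HasFiniteBiproducts C] [ExactCategory C] {X Y Z : C}

namespace YExt

variable {k} in
lemma smul_pull (c : k) (f : Z ⟶ Y) (x : YExt Y X) : pull (c • f) x = c • pull f x := by
  obtain ⟨a, rfl⟩ := mk_surjective x
  have central : push (c • 𝟙 X) (mk a) = pull (c • 𝟙 Y) (mk a) :=
    push_eq_pull a a _ (c • 𝟙 _) _ (by simp) (by simp)
  rw [smul_def, push_pull, central, ← pull_comp, Linear.comp_smul, Category.comp_id]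

variable {k} in
lemma smul_push (c : k) (g : X ⟶ Z) (x : YExt Y X) : push (c • g) x = c • push g x := by
  rw [smul_def, ← push_comp, Linear.comp_smul, Category.comp_id]

/-- The connecting homomorphism `Hom(K, Y) ⟶ Ext(K, X)` of a class `x` in `Ext(Y, X)`. -/
def contraConnecting (x : YExt Y X) (K : C) : (K ⟶ Y) →ₗ[k] YExt K X where
  toFun f := pull f x
  map_add' f f' := add_pull f f' x
  map_smul' c f := smul_pull c f x

/-- The connecting homomorphism `Hom(X, K) ⟶ Ext(Y, K)` of a class `x` in `Ext(Y, X)`. -/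
def covConnecting (x : YExt Y X) (K : C) : (X ⟶ K) →ₗ[k] YExt Y K where
  toFun g := push g x
  map_add' g g' := add_push g g' x
  map_smul' c g := smul_push c g x

lemma exact_rightComp_contraConnecting (a : Extension Y X) (K : C) :
    Function.Exact (Linear.rightComp k K a.d) (contraConnecting k (mk a) K) :=
  fun f => pull_eq_zero_iff f a

lemma exact_leftComp_covConnecting (a : Extension Y X) (K : C) :
    Function.Exact (Linear.leftComp k K a.i) (covConnecting k (mk a) K) :=
  fun g => push_eq_zero_iff g a

lemma exact_contraConnecting_pushₗ (a : Extension Y X) (K : C) :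
    Function.Exact (contraConnecting k (mk a) K) (pushₗ k a.i (Y := K)) := by
  refine fun x => ⟨fun hx => ?_, ?_⟩
  · obtain ⟨b, rfl⟩ := mk_surjective x
    obtain ⟨e, he⟩ := (push_eq_zero_iff a.i b).1 hx
    obtain ⟨f, hf⟩ := b.exists_desc (e ≫ a.d) (by rw [reassoc_of% he, a.w])
    exact ⟨f, pull_eq_of_hom b a f e he hf.symm⟩
  · rintro ⟨f, rfl⟩
    have hi : push a.i (mk a) = 0 := (push_eq_zero_iff a.i a).2 ⟨𝟙 _, Category.comp_id _⟩
    calc push a.i (pull f (mk a)) = pull f (push a.i (mk a)) := push_pull _ _ _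
      _ = 0 := by rw [hi]; exact (pullₗ k f).map_zero

lemma exact_covConnecting_pullₗ (a : Extension Y X) (K : C) :
    Function.Exact (covConnecting k (mk a) K) (pullₗ k a.d (X := K)) := by
  refine fun x => ⟨fun hx => ?_, ?_⟩
  · obtain ⟨b, rfl⟩ := mk_surjective x
    obtain ⟨e, he⟩ := (pull_eq_zero_iff a.d b).1 hx
    obtain ⟨g, hg⟩ := b.exists_lift (a.i ≫ e) (by rw [Category.assoc, he, a.w])
    exact ⟨g, push_eq_of_hom a b g e hg.symm he⟩
  · rintro ⟨g, rfl⟩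
    have hd : pull a.d (mk a) = 0 := (pull_eq_zero_iff a.d a).2 ⟨𝟙 _, Category.id_comp _⟩
    calc pull a.d (push g (mk a)) = push g (pull a.d (mk a)) := (push_pull _ _ _).symm
      _ = 0 := by rw [hd]; exact (pushₗ k g).map_zero

end YExt

/-- The class of a conflation `X ⟶ E ⟶ Y` in `Ext(Y, X)`. -/
def Conflation.extClass (ξ : Conflation C) : YExt ξ.obj.X₃ ξ.obj.X₁ :=
  YExt.mk (Extension.ofConflation ξ)

lemma Conflation.push_extClass_eq_pull_extClass {ξ ξ' : Conflation C} (m : ξ ⟶ ξ') :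
    YExt.push m.hom.τ₁ (extClass ξ) = YExt.pull m.hom.τ₃ (extClass ξ') :=
  YExt.push_eq_pull _ _ _ m.hom.τ₂ _ m.hom.comm₁₂.symm m.hom.comm₂₃

/-- The embedding `ξ^*(K) ⟶ Ext(K, X)` induced by the connecting homomorphism of a conflation
`ξ : X ⟶ E ⟶ Y`. -/
def contraDefectToExt (ξ : Conflation C) (K : C) : ContraDefect k ξ K →ₗ[k] YExt K ξ.obj.X₁ :=
  Submodule.liftQ _ (YExt.contraConnecting k ξ.extClass K)
    (YExt.exact_rightComp_contraConnecting k (.ofConflation ξ) K).linearMap_ker_eq.ge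

/-- The embedding `ξ_*(K) ⟶ Ext(Y, K)` induced by the connecting homomorphism of a conflation
`ξ : X ⟶ E ⟶ Y`. -/
def covDefectToExt (ξ : Conflation C) (K : C) : CovDefect k ξ K →ₗ[k] YExt ξ.obj.X₃ K :=
  Submodule.liftQ _ (YExt.covConnecting k ξ.extClass K)
    (YExt.exact_leftComp_covConnecting k (.ofConflation ξ) K).linearMap_ker_eq.ge

lemma contraDefectToExt_injective (ξ : Conflation C) (K : C) :
    Function.Injective (contraDefectToExt k ξ K) :=
  LinearMap.ker_eq_bot.1 <| Submodule.ker_liftQ_eq_bot _ _ _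
    (YExt.exact_rightComp_contraConnecting k (.ofConflation ξ) K).linearMap_ker_eq.le

lemma covDefectToExt_injective (ξ : Conflation C) (K : C) :
    Function.Injective (covDefectToExt k ξ K) :=
  LinearMap.ker_eq_bot.1 <| Submodule.ker_liftQ_eq_bot _ _ _
    (YExt.exact_leftComp_covConnecting k (.ofConflation ξ) K).linearMap_ker_eq.le

lemma exact_contraDefectToExt_pushₗ (ξ : Conflation C) (K : C) :
    Function.Exact (contraDefectToExt k ξ K) (YExt.pushₗ k ξ.obj.f (Y := K)) :=
  LinearMap.exact_iff.2 <|
    (YExt.exact_contraConnecting_pushₗ k (.ofConflation ξ) K).linearMap_ker_eq.trans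
      (Submodule.range_liftQ _ _ _).symm

lemma exact_covDefectToExt_pullₗ (ξ : Conflation C) (K : C) :
    Function.Exact (covDefectToExt k ξ K) (YExt.pullₗ k ξ.obj.g (X := K)) :=
  LinearMap.exact_iff.2 <|
    (YExt.exact_covConnecting_pullₗ k (.ofConflation ξ) K).linearMap_ker_eq.trans
      (Submodule.range_liftQ _ _ _).symm

lemma contraDefectToExt_mapConf {ξ ξ' : Conflation C} (m : ξ ⟶ ξ') (K : C)
    (y : ContraDefect k ξ K) :
    contraDefectToExt k ξ' K (contraDefectMapConf k m K y) =
      YExt.push m.hom.τ₁ (contraDefectToExt k ξ K y) := by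
  obtain ⟨f, rfl⟩ := Submodule.Quotient.mk_surjective _ y
  change YExt.pull (f ≫ m.hom.τ₃) ξ'.extClass = YExt.push m.hom.τ₁ (YExt.pull f ξ.extClass)
  rw [YExt.push_pull, Conflation.push_extClass_eq_pull_extClass, YExt.pull_comp]

lemma covDefectToExt_mapConf {ξ ξ' : Conflation C} (m : ξ ⟶ ξ') (K : C)
    (y : CovDefect k ξ' K) :
    covDefectToExt k ξ K (covDefectMapConf k m K y) =
      YExt.pull m.hom.τ₃ (covDefectToExt k ξ' K y) := by
  obtain ⟨g, rfl⟩ := Submodule.Quotient.mk_surjective _ y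
  change YExt.push (m.hom.τ₁ ≫ g) ξ.extClass = YExt.pull m.hom.τ₃ (YExt.push g ξ'.extClass)
  rw [← YExt.push_pull, ← Conflation.push_extClass_eq_pull_extClass, YExt.push_comp]

lemma contraDefectToExt_map (ξ : Conflation C) {K K' : C} (f : K ⟶ K')
    (y : ContraDefect k ξ K') :
    contraDefectToExt k ξ K (contraDefectMap k ξ f y) =
      YExt.pull f (contraDefectToExt k ξ K' y) := by
  obtain ⟨g, rfl⟩ := Submodule.Quotient.mk_surjective _ y
  exact YExt.pull_comp f g ξ.extClass

lemma covDefectToExt_map (ξ : Conflation C) {K K' : C} (f : K ⟶ K') (y : CovDefect k ξ K) :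
    covDefectToExt k ξ K' (covDefectMap k ξ f y) =
      YExt.push f (covDefectToExt k ξ K y) := by
  obtain ⟨g, rfl⟩ := Submodule.Quotient.mk_surjective _ y
  exact YExt.push_comp g f ξ.extClass

end ExactSequences

section StableCategories

variable {k : Type w} [CommRing k] {C : Type u} [Category.{v} C] [Preadditive C]
  [HasFiniteBiproducts C] [ExactCategory C]

instance [Linear k C] : (Quotient.functor (injRel C)).Linear k := Quotient.linear_functor ..

instance [Linear k C] : (Quotient.functor (projRel C)).Linear k := Quotient.linear_functor ..

lemma functor_map_eq_zero_iff_isInjTrivial {X Y : C} (g : X ⟶ Y) :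
    (Quotient.functor (injRel C)).map g = 0 ↔ IsInjTrivial g := by
  rw [← Functor.map_zero, Quotient.functor_map_eq_iff, injRel, sub_zero]

lemma functor_map_eq_zero_iff_isProjTrivial {X Y : C} (g : X ⟶ Y) :
    (Quotient.functor (projRel C)).map g = 0 ↔ IsProjTrivial g := by
  rw [← Functor.map_zero, Quotient.functor_map_eq_iff, projRel, sub_zero]

end StableCategories

section DefectFormula

variable {k : Type w} [CommRing k] {J : Type w} [AddCommGroup J] [Module k J]
  {C : Type u} [Category.{v} C] [Preadditive C] [Linear k C] [HasFiniteBiproducts C]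
  [ExactCategory C]

namespace Representation

variable {K K' : ProjStable C} (r : Representation k ((dExt k C J).obj K))
  (r' : Representation k ((dExt k C J).obj K'))

/-- The map `Hom(X, T) ⟶ D Ext(K, X)` on morphisms of `C` given by a representation
`Hom(-, T) ≃ D Ext(K, -)` on `C / I`. -/
def homToDualExt (X : C) : (X ⟶ r.obj.as) →ₗ[k] (YExt K.as X →ₗ[k] J) :=
  (r.iso ⟨X⟩).toLinearMap ∘ₗ (Quotient.functor (injRel C)).mapLinearMap k

lemma homToDualExt_surjective (X : C) : Function.Surjective (r.homToDualExt X) :=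
  (r.iso ⟨X⟩).surjective.comp (Functor.map_surjective (Quotient.functor (injRel C)))

lemma homToDualExt_eq_zero_iff {X : C} (g : X ⟶ r.obj.as) :
    r.homToDualExt X g = 0 ↔ IsInjTrivial g :=
  (r.iso ⟨X⟩).map_eq_zero_iff.trans (functor_map_eq_zero_iff_isInjTrivial g)

lemma homToDualExt_comp {X X' : C} (f : X ⟶ X') (g : X' ⟶ r.obj.as) :
    r.homToDualExt X (f ≫ g) = r.homToDualExt X' g ∘ₗ YExt.pushₗ k f :=
  r.natural ((Quotient.functor (injRel C)).map f) ((Quotient.functor (injRel C)).map g)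

/-- The map `Hom(X, T) ⟶ D ξ^*(K)` sending a morphism to the restriction to `ξ^*(K)` of
the associated form on `Ext(K, X)`. -/
def homToDualDefect (ξ : Conflation C) :
    (ξ.obj.X₁ ⟶ r.obj.as) →ₗ[k] (ContraDefect k ξ K.as →ₗ[k] J) :=
  LinearMap.lcomp k J (contraDefectToExt k ξ K.as) ∘ₗ r.homToDualExt ξ.obj.X₁

lemma homToDualDefect_surjective (hJ : Module.Baer k J) (ξ : Conflation C) :
    Function.Surjective (r.homToDualDefect ξ) :=
  Function.Surjective.comp (g := LinearMap.lcomp k J (contraDefectToExt k ξ K.as))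
    (hJ.extension_property _ (contraDefectToExt_injective k ξ K.as))
    (r.homToDualExt_surjective ξ.obj.X₁)

lemma exact_leftComp_homToDualDefect (hJ : Module.Baer k J) (ξ : Conflation C) :
    Function.Exact (Linear.leftComp k r.obj.as ξ.obj.f) (r.homToDualDefect ξ) :=
  exact_comp_of_comm_sq (α := r.homToDualExt ξ.obj.X₂)
    (exact_lcomp_of_baer hJ (exact_contraDefectToExt_pushₗ k ξ K.as))
    (LinearMap.ext fun h => r.homToDualExt_comp ξ.obj.f h)
    (r.homToDualExt_surjective ξ.obj.X₂)
    fun g hg => ((r.homToDualExt_eq_zero_iff g).1 hg).exists_factor ξ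

/-- The isomorphism `ξ_*(T) ≃ D ξ^*(K)` for an object `T` representing `D Ext(K, -)`. -/
def defectEquiv (hJ : Module.Baer k J) (ξ : Conflation C) :
    CovDefect k ξ r.obj.as ≃ₗ[k] (ContraDefect k ξ K.as →ₗ[k] J) :=
  (r.exact_leftComp_homToDualDefect hJ ξ).linearEquivOfSurjective
    (r.homToDualDefect_surjective hJ ξ)

lemma defectEquiv_mapConf (hJ : Module.Baer k J) {ξ ξ' : Conflation C} (m : ξ ⟶ ξ')
    (x : CovDefect k ξ' r.obj.as) :
    r.defectEquiv hJ ξ (covDefectMapConf k m _ x) =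
      r.defectEquiv hJ ξ' x ∘ₗ contraDefectMapConf k m _ := by
  obtain ⟨g, rfl⟩ := Submodule.Quotient.mk_surjective _ x
  refine LinearMap.ext fun y => ?_
  calc r.homToDualExt _ (m.hom.τ₁ ≫ g) (contraDefectToExt k ξ K.as y)
    _ = r.homToDualExt _ g (YExt.push m.hom.τ₁ (contraDefectToExt k ξ K.as y)) :=
      LinearMap.congr_fun (r.homToDualExt_comp m.hom.τ₁ g) _
    _ = r.homToDualExt _ g (contraDefectToExt k ξ' K.as (contraDefectMapConf k m K.as y)) := by
      rw [contraDefectToExt_mapConf]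

variable {r r'} in
lemma defectEquiv_map (hJ : Module.Baer k J) {f : K ⟶ K'} {t : r.obj ⟶ r'.obj}
    (hft : ∀ {Z : InjStable C} (g : Z ⟶ r.obj),
      r'.iso Z (g ≫ t) = (((dExt k C J).map f).app (op Z)).hom (r.iso Z g))
    (ξ : Conflation C) (x : (covDefectObj k ξ).obj r.obj) :
    r'.defectEquiv hJ ξ (((covDefectObj k ξ).map t).hom x) =
      r.defectEquiv hJ ξ x ∘ₗ ((contraDefectObj k ξ).map f.op).hom := by
  obtain ⟨g, rfl⟩ := Submodule.Quotient.mk_surjective _ x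
  obtain ⟨f⟩ := f
  obtain ⟨t⟩ := t
  refine LinearMap.ext fun y => ?_
  calc r'.homToDualExt _ (g ≫ t) (contraDefectToExt k ξ K'.as y)
    _ = r.homToDualExt _ g (YExt.pull f (contraDefectToExt k ξ K'.as y)) :=
      LinearMap.congr_fun (hft ((Quotient.functor (injRel C)).map g)) _
    _ = r.homToDualExt _ g (contraDefectToExt k ξ K.as (contraDefectMap k ξ f y)) := by
      rw [contraDefectToExt_map]

end Representation

namespace Corepresentation

variable {K K' : InjStable C} (r : Corepresentation k ((dExt k C J).flip.obj (op K)))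
  (r' : Corepresentation k ((dExt k C J).flip.obj (op K')))

/-- The map `Hom(T, Y) ⟶ D Ext(Y, K)` on morphisms of `C` given by a representation
`Hom(T, -) ≃ D Ext(-, K)` on `C / P`. -/
def homToDualExt (Y : C) : (r.obj.as ⟶ Y) →ₗ[k] (YExt Y K.as →ₗ[k] J) :=
  (r.iso ⟨Y⟩).toLinearMap ∘ₗ (Quotient.functor (projRel C)).mapLinearMap k

lemma homToDualExt_surjective (Y : C) : Function.Surjective (r.homToDualExt Y) :=
  (r.iso ⟨Y⟩).surjective.comp (Functor.map_surjective (Quotient.functor (projRel C)))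

lemma homToDualExt_eq_zero_iff {Y : C} (g : r.obj.as ⟶ Y) :
    r.homToDualExt Y g = 0 ↔ IsProjTrivial g :=
  (r.iso ⟨Y⟩).map_eq_zero_iff.trans (functor_map_eq_zero_iff_isProjTrivial g)

lemma homToDualExt_comp {Y Y' : C} (g : r.obj.as ⟶ Y) (f : Y ⟶ Y') :
    r.homToDualExt Y' (g ≫ f) = r.homToDualExt Y g ∘ₗ YExt.pullₗ k f :=
  r.natural ((Quotient.functor (projRel C)).map f) ((Quotient.functor (projRel C)).map g)

/-- The map `Hom(T, Y) ⟶ D ξ_*(K)` sending a morphism to the restriction to `ξ_*(K)` of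
the associated form on `Ext(Y, K)`. -/
def homToDualDefect (ξ : Conflation C) :
    (r.obj.as ⟶ ξ.obj.X₃) →ₗ[k] (CovDefect k ξ K.as →ₗ[k] J) :=
  LinearMap.lcomp k J (covDefectToExt k ξ K.as) ∘ₗ r.homToDualExt ξ.obj.X₃

lemma homToDualDefect_surjective (hJ : Module.Baer k J) (ξ : Conflation C) :
    Function.Surjective (r.homToDualDefect ξ) :=
  Function.Surjective.comp (g := LinearMap.lcomp k J (covDefectToExt k ξ K.as))
    (hJ.extension_property _ (covDefectToExt_injective k ξ K.as))
    (r.homToDualExt_surjective ξ.obj.X₃)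

lemma exact_rightComp_homToDualDefect (hJ : Module.Baer k J) (ξ : Conflation C) :
    Function.Exact (Linear.rightComp k r.obj.as ξ.obj.g) (r.homToDualDefect ξ) :=
  exact_comp_of_comm_sq (α := r.homToDualExt ξ.obj.X₂)
    (exact_lcomp_of_baer hJ (exact_covDefectToExt_pullₗ k ξ K.as))
    (LinearMap.ext fun h => r.homToDualExt_comp h ξ.obj.g)
    (r.homToDualExt_surjective ξ.obj.X₂)
    fun g hg => ((r.homToDualExt_eq_zero_iff g).1 hg).exists_factor ξ

/-- The isomorphism `ξ^*(T) ≃ D ξ_*(K)` for an object `T` representing `D Ext(-, K)`. -/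
def defectEquiv (hJ : Module.Baer k J) (ξ : Conflation C) :
    ContraDefect k ξ r.obj.as ≃ₗ[k] (CovDefect k ξ K.as →ₗ[k] J) :=
  (r.exact_rightComp_homToDualDefect hJ ξ).linearEquivOfSurjective
    (r.homToDualDefect_surjective hJ ξ)

lemma defectEquiv_mapConf (hJ : Module.Baer k J) {ξ ξ' : Conflation C} (m : ξ ⟶ ξ')
    (x : ContraDefect k ξ r.obj.as) :
    r.defectEquiv hJ ξ' (contraDefectMapConf k m _ x) =
      r.defectEquiv hJ ξ x ∘ₗ covDefectMapConf k m _ := by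
  obtain ⟨g, rfl⟩ := Submodule.Quotient.mk_surjective _ x
  refine LinearMap.ext fun y => ?_
  calc r.homToDualExt _ (g ≫ m.hom.τ₃) (covDefectToExt k ξ' K.as y)
    _ = r.homToDualExt _ g (YExt.pull m.hom.τ₃ (covDefectToExt k ξ' K.as y)) :=
      LinearMap.congr_fun (r.homToDualExt_comp g m.hom.τ₃) _
    _ = r.homToDualExt _ g (covDefectToExt k ξ K.as (covDefectMapConf k m K.as y)) := by
      rw [covDefectToExt_mapConf]

variable {r r'} in
lemma defectEquiv_map (hJ : Module.Baer k J) {f : K ⟶ K'} {t : r.obj ⟶ r'.obj}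
    (hft : ∀ {Z : ProjStable C} (g : r'.obj ⟶ Z),
      r.iso Z (t ≫ g) = (((dExt k C J).flip.map f.op).app Z).hom (r'.iso Z g))
    (ξ : Conflation C) (x : (contraDefectObj k ξ).obj (op r'.obj)) :
    r.defectEquiv hJ ξ (((contraDefectObj k ξ).map t.op).hom x) =
      r'.defectEquiv hJ ξ x ∘ₗ ((covDefectObj k ξ).map f).hom := by
  obtain ⟨g, rfl⟩ := Submodule.Quotient.mk_surjective _ x
  obtain ⟨f⟩ := f
  obtain ⟨t⟩ := t
  refine LinearMap.ext fun y => ?_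
  calc r.homToDualExt _ (t ≫ g) (covDefectToExt k ξ K.as y)
    _ = r'.homToDualExt _ g (YExt.push f (covDefectToExt k ξ K.as y)) :=
      LinearMap.congr_fun (hft ((Quotient.functor (projRel C)).map g)) _
    _ = r'.homToDualExt _ g (covDefectToExt k ξ K'.as (covDefectMap k ξ f y)) := by
      rw [covDefectToExt_map]

end Corepresentation

end DefectFormula

section RepresentingFunctor

universe v₁ u₁ v₂ u₂ x

variable {k : Type w} [CommRing k] {A : Type u₁} [Category.{v₁} A] {B : Type u₂}
  [Category.{v₂} B] [Preadditive B] [Linear k B]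

lemma iso_comp_representingFunctor_map (F : A ⥤ Bᵒᵖ ⥤ ModuleCat.{x} k)
    (r : ∀ a, Representation k (F.obj a)) {a a' : A} (f : a ⟶ a') {Z : B} (g : Z ⟶ (r a).obj) :
    (r a').iso Z (g ≫ (representingFunctor k F r).map f) =
      ((F.map f).app (op Z)).hom ((r a).iso Z g) := by
  have yoneda : (r a).iso Z g = ((F.obj a).map g.op).hom ((r a).iso _ (𝟙 _)) := by
    rw [← (r a).natural, Category.comp_id]
  calc (r a').iso Z (g ≫ (representingFunctor k F r).map f)
    _ = ((F.obj a').map g.op).hom ((r a').iso _ ((representingFunctor k F r).map f)) :=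
      (r a').natural g _
    _ = ((F.obj a').map g.op).hom (((F.map f).app _).hom ((r a).iso _ (𝟙 _))) := by
      simp only [representingFunctor, LinearEquiv.apply_symm_apply]
    _ = ((F.map f).app (op Z)).hom ((r a).iso Z g) := by
      rw [yoneda]
      exact (NatTrans.naturality_apply (F.map f) g.op _).symm

lemma iso_corepresentingFunctor_map_comp (F : Aᵒᵖ ⥤ B ⥤ ModuleCat.{x} k)
    (r : ∀ a : A, Corepresentation k (F.obj (op a))) {a a' : A} (f : a ⟶ a') {Z : B}
    (g : (r a').obj ⟶ Z) :
    (r a).iso Z ((corepresentingFunctor k F r).map f ≫ g) =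
      ((F.map f.op).app Z).hom ((r a').iso Z g) := by
  have yoneda : (r a').iso Z g = ((F.obj (op a')).map g).hom ((r a').iso _ (𝟙 _)) := by
    rw [← (r a').natural, Category.id_comp]
  calc (r a).iso Z ((corepresentingFunctor k F r).map f ≫ g)
    _ = ((F.obj (op a)).map g).hom ((r a).iso _ ((corepresentingFunctor k F r).map f)) :=
      (r a).natural g _
    _ = ((F.obj (op a)).map g).hom (((F.map f.op).app _).hom ((r a').iso _ (𝟙 _))) := by
      simp only [corepresentingFunctor, LinearEquiv.apply_symm_apply]
    _ = ((F.map f.op).app Z).hom ((r a').iso Z g) := by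
      rw [yoneda]
      exact (NatTrans.naturality_apply (F.map f.op) g _).symm

end RepresentingFunctor

section AuslanderReitenTranslation

variable {k : Type w} [CommRing k] {J : Type w} [AddCommGroup J] [Module k J]
  {C : Type u} [Category.{v} C] [Preadditive C] [Linear k C] [HasFiniteBiproducts C]
  [ExactCategory C]

lemma iso_comp_tau_map {K K' : StableCr k C J} (f : K ⟶ K') {Z : InjStable C}
    (g : Z ⟶ (tau k C J).obj K) :
    K'.property.some.iso Z (g ≫ (tau k C J).map f) =
      (((dExt k C J).map f.hom).app (op Z)).hom (K.property.some.iso Z g) :=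
  iso_comp_representingFunctor_map (ObjectProperty.ι _ ⋙ dExt k C J)
    (fun K : StableCr k C J => K.property.some) f g

lemma iso_tauInv_map_comp {K K' : StableCl k C J} (f : K ⟶ K') {Z : ProjStable C}
    (g : (tauInv k C J).obj K' ⟶ Z) :
    K.property.some.iso Z ((tauInv k C J).map f ≫ g) =
      (((dExt k C J).flip.map f.hom.op).app Z).hom (K'.property.some.iso Z g) :=
  iso_corepresentingFunctor_map_comp ((ObjectProperty.ι _).op ⋙ (dExt k C J).flip)
    (fun K : StableCl k C J => K.property.some) f g

end AuslanderReitenTranslation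

end AuslanderDefect
end

theorem theorem3p3_general {k : Type w} [CommRing k]
    {J : Type w} [AddCommGroup J] [Module k J] (hJ : Module.Injective k J)
    {C : Type u} [Category.{v} C] [Preadditive C] [Linear k C] [HasFiniteBiproducts C]
    [ExactCategory C] :
    (∃ e : ∀ (ξ : Conflation C) (K : StableCr k C J),
        ((covDefect k C).obj (op ξ)).obj ((tau k C J).obj K) ≃ₗ[k]
          (((contraDefect k C).obj ξ).obj (op K.obj) →ₗ[k] J),
      (∀ {ξ ξ' : Conflation C} (m : ξ ⟶ ξ') (K : StableCr k C J)
          (x : ((covDefect k C).obj (op ξ')).obj ((tau k C J).obj K)),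
        e ξ K ((((covDefect k C).map m.op).app ((tau k C J).obj K)).hom x) =
          e ξ' K x ∘ₗ (((contraDefect k C).map m).app (op K.obj)).hom) ∧
      (∀ (ξ : Conflation C) {K K' : StableCr k C J} (f : K ⟶ K')
          (x : ((covDefect k C).obj (op ξ)).obj ((tau k C J).obj K)),
        e ξ K' ((((covDefect k C).obj (op ξ)).map ((tau k C J).map f)).hom x) =
          e ξ K x ∘ₗ (((contraDefect k C).obj ξ).map f.hom.op).hom)) ∧
    (∃ e : ∀ (ξ : Conflation C) (K : StableCl k C J),
        ((contraDefect k C).obj ξ).obj (op ((tauInv k C J).obj K)) ≃ₗ[k]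
          (((covDefect k C).obj (op ξ)).obj K.obj →ₗ[k] J),
      (∀ {ξ ξ' : Conflation C} (m : ξ ⟶ ξ') (K : StableCl k C J)
          (x : ((contraDefect k C).obj ξ).obj (op ((tauInv k C J).obj K))),
        e ξ' K ((((contraDefect k C).map m).app (op ((tauInv k C J).obj K))).hom x) =
          e ξ K x ∘ₗ (((covDefect k C).map m.op).app K.obj).hom) ∧
      (∀ (ξ : Conflation C) {K K' : StableCl k C J} (f : K ⟶ K')
          (x : ((contraDefect k C).obj ξ).obj (op ((tauInv k C J).obj K'))),
        e ξ K ((((contraDefect k C).obj ξ).map ((tauInv k C J).map f).op).hom x) =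
          e ξ K' x ∘ₗ (((covDefect k C).obj (op ξ)).map f.hom).hom)) := by
  have baer : Module.Baer k J := .of_injective hJ
  refine ⟨⟨fun ξ K => K.property.some.defectEquiv baer ξ, ?_, ?_⟩,
    fun ξ K => K.property.some.defectEquiv baer ξ, ?_, ?_⟩
  · exact fun m K x => K.property.some.defectEquiv_mapConf baer m x
  · exact fun ξ K K' f x => Representation.defectEquiv_map (r := K.property.some)
      (r' := K'.property.some) baer (iso_comp_tau_map f) ξ x
  · exact fun m K x => K.property.some.defectEquiv_mapConf baer m x
  · exact fun ξ K K' f x => Corepresentation.defectEquiv_map (r := K.property.some)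
      (r' := K'.property.some) baer (iso_tauInv_map_comp f) ξ x

theorem theorem3p3 {k : Type w} [CommRing k] [IsArtinianRing k]
    {J : Type w} [AddCommGroup J] [Module k J] (hJ : IsMinimalInjectiveCogenerator k J)
    {C : Type u} [Category.{v} C] [Preadditive C] [Linear k C] [HasFiniteBiproducts C]
    [ExactCategory C] [KrullSchmidt C] [∀ X Y : C, Module.Finite k (X ⟶ Y)] :
    (∃ e : ∀ (ξ : Conflation C) (K : StableCr k C J),
        ((covDefect k C).obj (op ξ)).obj ((tau k C J).obj K) ≃ₗ[k]
          (((contraDefect k C).obj ξ).obj (op K.obj) →ₗ[k] J),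
      (∀ {ξ ξ' : Conflation C} (m : ξ ⟶ ξ') (K : StableCr k C J)
          (x : ((covDefect k C).obj (op ξ')).obj ((tau k C J).obj K)),
        e ξ K ((((covDefect k C).map m.op).app ((tau k C J).obj K)).hom x) =
          e ξ' K x ∘ₗ (((contraDefect k C).map m).app (op K.obj)).hom) ∧
      (∀ (ξ : Conflation C) {K K' : StableCr k C J} (f : K ⟶ K')
          (x : ((covDefect k C).obj (op ξ)).obj ((tau k C J).obj K)),
        e ξ K' ((((covDefect k C).obj (op ξ)).map ((tau k C J).map f)).hom x) =
          e ξ K x ∘ₗ (((contraDefect k C).obj ξ).map f.hom.op).hom)) ∧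
    (∃ e : ∀ (ξ : Conflation C) (K : StableCl k C J),
        ((contraDefect k C).obj ξ).obj (op ((tauInv k C J).obj K)) ≃ₗ[k]
          (((covDefect k C).obj (op ξ)).obj K.obj →ₗ[k] J),
      (∀ {ξ ξ' : Conflation C} (m : ξ ⟶ ξ') (K : StableCl k C J)
          (x : ((contraDefect k C).obj ξ).obj (op ((tauInv k C J).obj K))),
        e ξ' K ((((contraDefect k C).map m).app (op ((tauInv k C J).obj K))).hom x) =
          e ξ K x ∘ₗ (((covDefect k C).map m.op).app K.obj).hom) ∧
      (∀ (ξ : Conflation C) {K K' : StableCl k C J} (f : K ⟶ K')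
          (x : ((contraDefect k C).obj ξ).obj (op ((tauInv k C J).obj K'))),
        e ξ K ((((contraDefect k C).obj ξ).map ((tauInv k C J).map f).op).hom x) =
          e ξ K' x ∘ₗ (((covDefect k C).obj (op ξ)).map f.hom).hom)) :=
  theorem3p3_general hJ.injective
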